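/- Let $n$ and $N$ be positive integers and let $\mathfrak a_1,\ldots,\mathfrak a_N\in\mathbb Z^n$ be distinct vectors that generate a sublattice of rank $n$ and for which there is $\mathfrak a_0^\vee\in\operatorname{Hom}(\mathbb Z^n,\mathbb Z)$ with $\mathfrak a_0^\vee\cdot\mathfrak a_i=1$ for all $i$. Write $\mathsf A=(a_{ij})$ for the $n\times N$ matrix with columns $\mathfrak a_1,\ldots,\mathfrak a_N$, $\Delta=\operatorname{conv}\{\mathfrak a_1,\ldots,\mathfrak a_N\}\subset\mathbb R^n$, and $\mathbb L=\{\ell\in\mathbb Z^N\mid \sum_j\ell_j\mathfrak a_j=0\}$, $\mathbb L_{\mathbb Z}^\vee=\operatorname{Hom}(\mathbb L,\mathbb Z)$, and let $\mathfrak b_j\in\mathbb L_{\mathbb Z}^\vee$ be the restriction to $\mathbb L$ of the $j$-th coordinate function. The volume of a simplex $\operatorname{conv}\{\mathfrak a_{i_1},\ldots,\mathfrak a_{i_n}\}$ is $|\det(\mathfrak a_{i_1},\ldots,\mathfrak a_{i_n})|$, and $\operatorname{vol}\Delta$ is the volume of $\Delta$ in this normalization, i.e. $n!$ times the Lebesgue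 measure of $\operatorname{conv}(\Delta\cup\{0\})$. Let $\mathcal T$ be a regular triangulation of $\Delta$ with vertices among the $\mathfrak a_i$. That is, there is $(d_1,\ldots,d_N)\in\mathbb R_{>0}^N$ such that for all $I\subset\{1,\ldots,N\}$ with $(\mathfrak a_i)_{i\in I}$ a basis of $\mathbb R^n$ and all $j\notin I$ the point $d_j^{-1}\mathfrak a_j$ does not lie on the affine hyperplane through the points $d_i^{-1}\mathfrak a_i$ $(i\in I)$, and the maximal simplices of $\mathcal T$ are the $\operatorname{conv}\{\mathfrak a_i\mid i\in I\}$ for those $I$ for which all $d_j^{-1}\mathfrak a_j$, $j\notin I$, lie on the same side of this hyperplane as $0$. Simplices are identified with their index sets, and $\mathcal T^m$ denotes the set of simplices with $m$ vertices. Let $D$ be the product of the volumes of the maximal simplices, and let $$\mathcal R_{\mathsf A,\mathcal T}=\mathbb Z[D^{-1}][C_1,\ldots,C_N]/\mathcal J ,$$ where the ideal $\mathcal J$ is generated by the linear forms $a_{i1}C_1+\cdots+a_{iN}C_N$ $(i=1,\ldots,n)$ and the monomials $\prod_{i\in F}C_i$ for the $F\subset\{1,\ldots,N\}$ that are not a simplex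 of $\mathcal T$. Let $c_j$ be the image of $C_j$ and $\mathcal R_{\mathsf A,\mathcal T}^{(1)}$ the homogeneous component of degree $1$ of $\mathcal R_{\mathsf A,\mathcal T}$. If $\mathcal T$ is unimodular, i.e. all its maximal simplices have volume $1$, then: 1. $\mathcal R_{\mathsf A,\mathcal T}$ is a free $\mathbb Z$-module of finite rank, and its rank is equal to $\operatorname{vol}\Delta$; 2. $\Delta\cap\mathbb Z^n=\mathcal T^1=\{\mathfrak a_1,\ldots,\mathfrak a_N\}$, where $\mathcal T^1$ is regarded as the set of vertices of $\mathcal T$; 3. there is an isomorphism of $\mathbb Z$-modules $\mathcal R_{\mathsf A,\mathcal T}^{(1)}\to\mathbb L_{\mathbb Z}^\vee$ under which $c_j$ corresponds to $\mathfrak b_j$ for $j=1,\ldots,N$. -/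

import Mathlib

open scoped Nat

namespace GKZ

noncomputable section

/-- The integer vector `z`, regarded as a point of `ℝⁿ`. -/
def toReal {n : ℕ} (z : Fin n → ℤ) : Fin n → ℝ := fun i => (z i : ℝ)

/-- The standing conditions on `𝔞₁, …, 𝔞_N ∈ ℤⁿ`: they generate a sublattice of rank `n`, and they
lie on a common affine hyperplane `𝔞₀^∨ · x = 1` with `𝔞₀^∨` integral. -/
structure StandardCondition {n N : ℕ} (a : Fin N → Fin n → ℤ) : Prop where
  rank_span : Module.finrank ℤ (Submodule.span ℤ (Set.range a)) = n
  hyperplane : ∃ a₀ : Fin n → ℤ, ∀ i, a₀ ⬝ᵥ a i = 1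

/-- The polytope `Δ = conv {𝔞₁, …, 𝔞_N}`. -/
def polytope {n N : ℕ} (a : Fin N → Fin n → ℤ) : Set (Fin n → ℝ) :=
  convexHull ℝ (Set.range fun i => toReal (a i))

/-- The volume of a polytope `P` lying in an affine hyperplane `𝔞₀^∨ · x = 1` of `ℝⁿ`
(`𝔞₀^∨` integral), normalized so that `conv {𝔞_{i₁}, …, 𝔞_{iₙ}}` has volume
`|det (𝔞_{i₁}, …, 𝔞_{iₙ})|`: it is `n!` times the Lebesgue measure of the pyramid over `P` with
apex `0`. -/
def normalizedVolume {n : ℕ} (P : Set (Fin n → ℝ)) : ℝ :=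
  (n ! : ℝ) * MeasureTheory.volume.real (convexHull ℝ (insert 0 P))

/-- The volume `|det (𝔞_{i₁}, …, 𝔞_{iₙ})|` of the simplex `conv {𝔞_{i₁}, …, 𝔞_{iₙ}}`, where
`I = {i₁ < ⋯ < iₙ}` is given by its increasing enumeration. -/
def simplexVolume {n N : ℕ} (a : Fin N → Fin n → ℤ) (I : Fin n ↪o Fin N) : ℤ :=
  |(Matrix.of fun r k : Fin n => a (I k) r).det|

/-- The determinant of the `(n+1) × (n+1)` matrix whose columns are
`(d_{i₁}⁻¹ 𝔞_{i₁}, 1), …, (d_{iₙ}⁻¹ 𝔞_{iₙ}, 1), (x, 1)`; as a function of `x` it vanishes on the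
affine hyperplane through the points `d_i⁻¹ 𝔞_i`, `i ∈ I`. -/
def hyperplaneDet {n N : ℕ} (a : Fin N → Fin n → ℤ) (d : Fin N → ℝ) (I : Fin n ↪o Fin N)
    (x : Fin n → ℝ) : ℝ :=
  (Matrix.fromBlocks
    (Matrix.of fun r k : Fin n => (d (I k))⁻¹ * toReal (a (I k)) r)
    (Matrix.of fun (r : Fin n) (_ : Unit) => x r)
    (Matrix.of fun (_ : Unit) (_ : Fin n) => (1 : ℝ))
    (Matrix.of fun (_ : Unit) (_ : Unit) => (1 : ℝ))).det

/-- The vectors `𝔞_{i₁}, …, 𝔞_{iₙ}` are linearly independent. -/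
def IndepAt {n N : ℕ} (a : Fin N → Fin n → ℤ) (I : Fin n ↪o Fin N) : Prop :=
  LinearIndependent ℝ fun k => toReal (a (I k))

/-- `d` lies on none of the hyperplanes `D_{d,I}(d_j⁻¹ 𝔞_j) = 0`, `j ∉ I`. -/
def IsGeneric {n N : ℕ} (a : Fin N → Fin n → ℤ) (d : Fin N → ℝ) : Prop :=
  ∀ I : Fin n ↪o Fin N, IndepAt a I → ∀ j ∉ Set.range I,
    hyperplaneDet a d I ((d j)⁻¹ • toReal (a j)) ≠ 0

/-- `T` is the set of maximal simplices of a regular triangulation of `Δ`: for some generic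
`d = (d₁, …, d_N)` with positive entries, `T` consists of the `I` for which the points `d_i⁻¹ 𝔞_i`,
`i ∈ I`, span a facet of `conv {0, d₁⁻¹ 𝔞₁, …, d_N⁻¹ 𝔞_N}` opposite to `0`, i.e. for which every
`d_j⁻¹ 𝔞_j`, `j ∉ I`, lies strictly on the same side as `0` of the hyperplane through them.
A triangulation is determined by its set of maximal simplices, and simplices are given by their
index sets. -/
def IsRegularTriangulation {n N : ℕ} (a : Fin N → Fin n → ℤ) (T : Finset (Fin n ↪o Fin N)) :
    Prop :=
  ∃ d : Fin N → ℝ, (∀ j, 0 < d j) ∧ IsGeneric a d ∧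
    ∀ I : Fin n ↪o Fin N, I ∈ T ↔
      IndepAt a I ∧ ∀ j ∉ Set.range I,
        0 < hyperplaneDet a d I ((d j)⁻¹ • toReal (a j)) * hyperplaneDet a d I 0

/-- All maximal simplices have volume `1`. -/
def IsUnimodular {n N : ℕ} (a : Fin N → Fin n → ℤ) (T : Finset (Fin n ↪o Fin N)) : Prop :=
  ∀ I ∈ T, simplexVolume a I = 1

/-- `F` is (the index set of) a simplex of the triangulation with maximal simplices `T`. -/
def IsSimplex {n N : ℕ} (T : Finset (Fin n ↪o Fin N)) (F : Finset (Fin N)) : Prop :=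
  ∃ I ∈ T, (F : Set (Fin N)) ⊆ Set.range I

/-- `T^m`: the simplices of the triangulation that have `m` vertices. -/
def simplices {n N : ℕ} (T : Finset (Fin n ↪o Fin N)) (m : ℕ) : Set (Finset (Fin N)) :=
  {F | IsSimplex T F ∧ F.card = m}

/-- The points `𝔞_i` of `ℝⁿ` with `{i} ∈ T^1`, i.e. the vertices of the triangulation. -/
def vertices {n N : ℕ} (a : Fin N → Fin n → ℤ) (T : Finset (Fin n ↪o Fin N)) :
    Set (Fin n → ℝ) :=
  {x | ∃ i, {i} ∈ simplices T 1 ∧ x = toReal (a i)}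

/-- `D`: the product of the volumes of the maximal simplices. -/
def volumeProduct {n N : ℕ} (a : Fin N → Fin n → ℤ) (T : Finset (Fin n ↪o Fin N)) : ℤ :=
  ∏ I ∈ T, simplexVolume a I

/-- The subring `ℤ[D⁻¹]` of `ℚ`, for a non-zero integer `D`. -/
def intAdjoinInv (D : ℤ) : Subring ℚ := Subring.closure {(D : ℚ)⁻¹}

/-- The coefficient ring `ℤ[D⁻¹]`. -/
abbrev CoeffRing {n N : ℕ} (a : Fin N → Fin n → ℤ) (T : Finset (Fin n ↪o Fin N)) : Type :=
  intAdjoinInv (volumeProduct a T)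

/-- The ideal `𝒥` of `ℤ[D⁻¹][C₁, …, C_N]` generated by the linear forms
`a_{r1} C₁ + ⋯ + a_{rN} C_N` and the monomials `∏ i ∈ F, C_i` with `F` not a simplex of `T`. -/
def relationIdeal {n N : ℕ} (a : Fin N → Fin n → ℤ) (T : Finset (Fin n ↪o Fin N)) :
    Ideal (MvPolynomial (Fin N) (CoeffRing a T)) :=
  Ideal.span
    ((Set.range fun r : Fin n =>
        ∑ j : Fin N, MvPolynomial.C ((a j r : ℤ) : CoeffRing a T) * MvPolynomial.X j) ∪
      {p | ∃ F : Finset (Fin N), ¬ IsSimplex T F ∧ p = ∏ i ∈ F, MvPolynomial.X i})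

/-- The ring `ℛ_{A,T} = ℤ[D⁻¹][C₁, …, C_N] / 𝒥`. -/
abbrev RingR {n N : ℕ} (a : Fin N → Fin n → ℤ) (T : Finset (Fin n ↪o Fin N)) : Type :=
  MvPolynomial (Fin N) (CoeffRing a T) ⧸ relationIdeal a T

/-- The image `c_j` of `C_j` in `ℛ_{A,T}`. -/
def c {n N : ℕ} (a : Fin N → Fin n → ℤ) (T : Finset (Fin n ↪o Fin N)) (j : Fin N) : RingR a T :=
  Ideal.Quotient.mk (relationIdeal a T) (MvPolynomial.X j)

/-- The homogeneous component `ℛ_{A,T}^{(k)}` of degree `k`: the image of the homogeneous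
polynomials of degree `k`. -/
def gradedPart {n N : ℕ} (a : Fin N → Fin n → ℤ) (T : Finset (Fin n ↪o Fin N)) (k : ℕ) :
    Submodule (CoeffRing a T) (RingR a T) :=
  (MvPolynomial.homogeneousSubmodule (Fin N) (CoeffRing a T) k).map
    (Ideal.Quotient.mkₐ (CoeffRing a T) (relationIdeal a T)).toLinearMap

/-- The lattice `𝕃 = {ℓ ∈ ℤ^N | ℓ₁ 𝔞₁ + ⋯ + ℓ_N 𝔞_N = 0}`. -/
def lattice {n N : ℕ} (a : Fin N → Fin n → ℤ) : Submodule ℤ (Fin N → ℤ) :=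
  LinearMap.ker (Fintype.linearCombination ℤ a)

/-- `𝔟_j ∈ 𝕃_ℤ^∨ = Hom(𝕃, ℤ)`: the restriction to `𝕃` of the `j`-th coordinate function on
`ℤ^N`. -/
def b {n N : ℕ} (a : Fin N → Fin n → ℤ) (j : Fin N) : Module.Dual ℤ (lattice a) :=
  (LinearMap.proj j : (Fin N → ℤ) →ₗ[ℤ] ℤ) ∘ₗ (lattice a).subtype

end

end GKZ

/-! A regular triangulation is the normal fan of a polyhedron. With $d$ the defining weights, put
$P=\{y \mid y\cdot\mathfrak a_j\le d_j\}$; the maximal simplices $I\in\mathcal T$ correspond to the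
vertices $y_I$ of $P$, and $I$ is the set of constraints tight at $y_I$ (`IsVertexSystem`). All the
geometry comes from linear programming on $P$. If a coordinate of a point $w$ of the cone in the
basis $I$ is negative, a simplex-method pivot leads to a vertex with a greater value of $y\cdot w$
(`exists_pivot`). Hence a maximizing vertex has $w$ in its cone, and the cones cover. For generic
$w$ the values $y_I\cdot w$ order the simplices into a line shelling, the minimal new face $\eta(I)$
being the vertices of $I$ at which $w$ has a negative coordinate.

Unimodularity lets every basis change be made over $\mathbb Z$. By the shelling, the Stanley–Reisner
ring is free over the polynomial ring in the $n$ linear forms, with basis the monomials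
$\prod_{i\in\eta(I)}C_i$: generation is a straightening argument (`isGenerated`), independence a
triangularity argument after restriction to single simplices (`eq_zero_of_sum_mem`). Killing the
linear forms leaves a basis indexed by $\mathcal T$, over $\mathbb Z$ because $D=1$.

The pyramid over $\Delta$ is a union of $|\mathcal T|$ simplices of Lebesgue measure $1/n!$ that
overlap in null sets, so $\operatorname{vol}\Delta=|\mathcal T|$ too. A lattice point of $\Delta$
has nonnegative integral coordinates with sum $1$ in some $I$, hence is a vertex. Finally $\mathcal
R^{(1)}$ and $\mathbb L_{\mathbb Z}^\vee$ are both the quotient of $\mathbb Z^N$ by the row lattice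
of $\mathsf A$. -/

namespace GKZ

/-! ### The dual polyhedron, pivoting and the shelling -/

noncomputable section

open Matrix

variable {n N : ℕ} {a : Fin N → Fin n → ℤ} {T : Finset (Fin n ↪o Fin N)}

/-- The real matrix with columns `𝔞_{f 1}, …, 𝔞_{f n}`. -/
def colMatrix (a : Fin N → Fin n → ℤ) (f : Fin n → Fin N) : Matrix (Fin n) (Fin n) ℝ :=
  Matrix.of fun r k => toReal (a (f k)) r

theorem colMatrix_mulVec (f : Fin n → Fin N) (x : Fin n → ℝ) :
    colMatrix a f *ᵥ x = ∑ k, x k • toReal (a (f k)) := by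
  ext r
  simp [colMatrix, Matrix.mulVec, dotProduct, mul_comm]

theorem isUnit_det_colMatrix {f : Fin n → Fin N}
    (hf : LinearIndependent ℝ fun k => toReal (a (f k))) : IsUnit (colMatrix a f).det := by
  rw [← Matrix.isUnit_iff_isUnit_det, ← Matrix.linearIndependent_cols_iff_isUnit]
  exact hf

/-- The coordinates of `w` with respect to the basis `𝔞_{f 1}, …, 𝔞_{f n}`. -/
def coords (a : Fin N → Fin n → ℤ) (f : Fin n → Fin N) (w : Fin n → ℝ) : Fin n → ℝ :=
  (colMatrix a f)⁻¹ *ᵥ w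

theorem sum_coords {f : Fin n → Fin N} (hf : LinearIndependent ℝ fun k => toReal (a (f k)))
    (w : Fin n → ℝ) : ∑ k, coords a f w k • toReal (a (f k)) = w := by
  rw [← colMatrix_mulVec, coords, Matrix.mulVec_mulVec,
    Matrix.mul_nonsing_inv _ (isUnit_det_colMatrix hf), Matrix.one_mulVec]

theorem inv_colMatrix_dotProduct {f : Fin n → Fin N}
    (hf : LinearIndependent ℝ fun k => toReal (a (f k))) (k l : Fin n) :
    (colMatrix a f)⁻¹ k ⬝ᵥ toReal (a (f l)) = if k = l then 1 else 0 := by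
  have := congrFun (congrFun (Matrix.nonsing_inv_mul _ (isUnit_det_colMatrix hf)) k) l
  rw [Matrix.one_apply] at this
  rw [← this]
  rfl

/-- The point `y` with `y · 𝔞_i = d_i` for `i ∈ I`. -/
def vertexPoint (a : Fin N → Fin n → ℤ) (d : Fin N → ℝ) (f : Fin n → Fin N) : Fin n → ℝ :=
  (fun k => d (f k)) ᵥ* (colMatrix a f)⁻¹

theorem vertexPoint_dotProduct (d : Fin N → ℝ) {f : Fin n → Fin N}
    (hf : LinearIndependent ℝ fun k => toReal (a (f k))) (k : Fin n) :
    vertexPoint a d f ⬝ᵥ toReal (a (f k)) = d (f k) := by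
  have : (vertexPoint a d f ᵥ* colMatrix a f) k = d (f k) := by
    rw [vertexPoint, Matrix.vecMul_vecMul, Matrix.nonsing_inv_mul _ (isUnit_det_colMatrix hf),
      Matrix.vecMul_one]
  exact this

theorem eq_of_dotProduct_eq {f : Fin n → Fin N}
    (hf : LinearIndependent ℝ fun k => toReal (a (f k))) {y z : Fin n → ℝ}
    (h : ∀ k, y ⬝ᵥ toReal (a (f k)) = z ⬝ᵥ toReal (a (f k))) : y = z := by
  have h' : y ᵥ* colMatrix a f = z ᵥ* colMatrix a f := funext h
  have := congrArg (· ᵥ* (colMatrix a f)⁻¹) h'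
  simpa [Matrix.vecMul_vecMul, Matrix.mul_nonsing_inv _ (isUnit_det_colMatrix hf)] using this

/-- Schur complement with respect to the upper left block, whose determinant is `D`. It turns the
sign conditions on determinants into inequalities $y\cdot\mathfrak a_j<d_j$ at the point $y$ tight
on $I$. -/
theorem hyperplaneDet_eq {d : Fin N → ℝ} (hd : ∀ j, 0 < d j) {I : Fin n ↪o Fin N}
    (hI : IndepAt a I) :
    ∃ D : ℝ, D ≠ 0 ∧ ∀ x, hyperplaneDet a d I x = D * (1 - vertexPoint a d I ⬝ᵥ x) := by
  set B : Matrix (Fin n) (Fin n) ℝ :=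
    Matrix.of fun r k : Fin n => (d (I k))⁻¹ * toReal (a (I k)) r with hB
  have hBM : B = colMatrix a I * Matrix.diagonal fun k => (d (I k))⁻¹ := by
    ext r k
    simp [hB, colMatrix, mul_comm]
  have hdet : B.det ≠ 0 := by
    rw [hBM, Matrix.det_mul, Matrix.det_diagonal]
    exact mul_ne_zero (isUnit_det_colMatrix hI).ne_zero
      (Finset.prod_ne_zero_iff.2 fun k _ => inv_ne_zero (hd _).ne')
  refine ⟨B.det, hdet, fun x => ?_⟩
  let _ : Invertible B := B.invertibleOfIsUnitDet (isUnit_iff_ne_zero.2 hdet)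
  have hrow : (Matrix.of fun (_ : Unit) (_ : Fin n) => (1 : ℝ)) * ⅟B =
      Matrix.of fun (_ : Unit) r => vertexPoint a d I r := by
    rw [Matrix.mul_invOf_eq_iff_eq_mul_right]
    ext u k
    have := vertexPoint_dotProduct d hI k
    simp only [dotProduct] at this
    simp only [Matrix.of_apply, Matrix.mul_apply, hB]
    calc (1 : ℝ) = (d (I k))⁻¹ * d (I k) := (inv_mul_cancel₀ (hd _).ne').symm
      _ = _ := by
        rw [← this, Finset.mul_sum]
        exact Finset.sum_congr rfl fun r _ => by ring
  rw [hyperplaneDet, Matrix.det_fromBlocks₁₁, hrow, Matrix.det_unique (n := Unit)]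
  simp [Matrix.mul_apply, dotProduct, hB]

/-- The vertices `y I`, `I ∈ T`, of the polyhedron `{y | y · 𝔞_j ≤ d_j}`, whose normal fan is the
triangulation `T`. -/
structure IsVertexSystem (a : Fin N → Fin n → ℤ) (T : Finset (Fin n ↪o Fin N)) (d : Fin N → ℝ)
    (y : (Fin n ↪o Fin N) → Fin n → ℝ) : Prop where
  pos : ∀ j, 0 < d j
  indep : ∀ I ∈ T, IndepAt a I
  le : ∀ I ∈ T, ∀ j, y I ⬝ᵥ toReal (a j) ≤ d j
  eq_iff : ∀ I ∈ T, ∀ j, y I ⬝ᵥ toReal (a j) = d j ↔ j ∈ Set.range I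
  complete : ∀ (f : Fin n → Fin N) (z : Fin n → ℝ),
    (LinearIndependent ℝ fun k => toReal (a (f k))) →
    (∀ k, z ⬝ᵥ toReal (a (f k)) = d (f k)) → (∀ j, z ⬝ᵥ toReal (a j) ≤ d j) →
    ∃ I ∈ T, Set.range I = Set.range f ∧ y I = z

theorem exists_orderEmbedding_of_injective {f : Fin n → Fin N} (hf : Function.Injective f) :
    ∃ (I : Fin n ↪o Fin N) (σ : Fin n ≃ Fin n), ∀ k, I k = f (σ k) := by
  have hc : (Finset.univ.image f).card = n := by
    simp [Finset.card_image_of_injective _ hf]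
  set I := (Finset.univ.image f).orderEmbOfFin hc with hI
  have hmem : ∀ k, ∃ l, f l = I k := fun k => by
    obtain ⟨l, -, hl⟩ := Finset.mem_image.1 (Finset.orderEmbOfFin_mem _ hc k)
    exact ⟨l, hl⟩
  choose σ hσ using hmem
  have hσi : Function.Injective σ := fun k l h => I.injective (by rw [← hσ, ← hσ, h])
  exact ⟨I, Equiv.ofBijective σ (Finite.injective_iff_bijective.1 hσi), fun k => (hσ k).symm⟩

theorem IsRegularTriangulation.exists_isVertexSystem (hreg : IsRegularTriangulation a T) :
    ∃ d y, IsVertexSystem a T d y := by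
  obtain ⟨d, hd, hgen, hT⟩ := hreg
  have hne : ∀ I, IndepAt a I → ∀ j ∉ Set.range I, vertexPoint a d I ⬝ᵥ toReal (a j) ≠ d j := by
    intro I hI j hj h
    obtain ⟨D, -, hx⟩ := hyperplaneDet_eq hd hI
    apply hgen I hI j hj
    rw [hx, dotProduct_smul, h, smul_eq_mul, inv_mul_cancel₀ (hd j).ne', sub_self, mul_zero]
  have hlt : ∀ I, IndepAt a I → ∀ j,
      0 < hyperplaneDet a d I ((d j)⁻¹ • toReal (a j)) * hyperplaneDet a d I 0 ↔
        vertexPoint a d I ⬝ᵥ toReal (a j) < d j := by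
    intro I hI j
    obtain ⟨D, hD, hx⟩ := hyperplaneDet_eq hd hI
    rw [hx, hx, dotProduct_smul, dotProduct_zero, sub_zero, mul_one, smul_eq_mul,
      show ∀ s : ℝ, D * s * D = (D * D) * s from fun s => by ring,
      mul_pos_iff_of_pos_left (mul_self_pos.2 hD), sub_pos, inv_mul_lt_iff₀ (hd j), mul_one]
  refine ⟨d, fun I => vertexPoint a d I, hd, fun I hI => ((hT I).1 hI).1, ?_, ?_, ?_⟩
  · intro I hI j
    by_cases hj : j ∈ Set.range I
    · obtain ⟨k, rfl⟩ := hj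
      exact (vertexPoint_dotProduct d ((hT I).1 hI).1 k).le
    · exact ((hlt I ((hT I).1 hI).1 j).1 (((hT I).1 hI).2 j hj)).le
  · intro I hI j
    constructor
    · intro h
      by_contra hj
      exact hne I ((hT I).1 hI).1 j hj h
    · rintro ⟨k, rfl⟩
      exact vertexPoint_dotProduct d ((hT I).1 hI).1 k
  · intro f z hf hz hle
    have hinj : Function.Injective f := fun k l h =>
      hf.injective (congrArg (fun j => toReal (a j)) h)
    obtain ⟨I, σ, hσ⟩ := exists_orderEmbedding_of_injective hinj
    have hI : IndepAt a I := by
      have := hf.comp σ σ.injective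
      simpa only [IndepAt, hσ, Function.comp_def] using this
    have hyz : vertexPoint a d I = z := eq_of_dotProduct_eq hI fun k => by
      rw [vertexPoint_dotProduct d hI, hσ, hz]
    refine ⟨I, (hT I).2 ⟨hI, fun j hj => ?_⟩, ?_, hyz⟩
    · rw [hlt I hI, hyz]
      exact lt_of_le_of_ne (hle j) (hyz ▸ hne I hI j hj)
    · rw [show (I : Fin n → Fin N) = f ∘ σ from funext hσ, σ.surjective.range_comp]

/-- The ratio test: moving from `z` in the direction `u`, one meets a first constraint. -/
theorem exists_ratio (d : Fin N → ℝ) {z u : Fin n → ℝ} (hz : ∀ j, z ⬝ᵥ toReal (a j) ≤ d j)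
    (hu : ∃ j, 0 < u ⬝ᵥ toReal (a j)) :
    ∃ (t : ℝ) (j : Fin N), 0 ≤ t ∧ 0 < u ⬝ᵥ toReal (a j) ∧
      (t = 0 → z ⬝ᵥ toReal (a j) = d j) ∧
      (z + t • u) ⬝ᵥ toReal (a j) = d j ∧ ∀ i, (z + t • u) ⬝ᵥ toReal (a i) ≤ d i := by
  obtain ⟨j₀, hj₀⟩ := hu
  obtain ⟨j, hj, hmin⟩ := (Finset.univ.filter fun j => 0 < u ⬝ᵥ toReal (a j)).exists_min_image
    (fun j => (d j - z ⬝ᵥ toReal (a j)) / (u ⬝ᵥ toReal (a j))) ⟨j₀, by simpa using hj₀⟩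
  simp only [Finset.mem_filter, Finset.mem_univ, true_and] at hj hmin
  set t := (d j - z ⬝ᵥ toReal (a j)) / (u ⬝ᵥ toReal (a j)) with ht
  have ht0 : 0 ≤ t := div_nonneg (sub_nonneg.2 (hz j)) hj.le
  have htj : t * (u ⬝ᵥ toReal (a j)) = d j - z ⬝ᵥ toReal (a j) := div_mul_cancel₀ _ hj.ne'
  refine ⟨t, j, ht0, hj, fun h => ?_, ?_, fun i => ?_⟩
  · rw [h, zero_mul] at htj
    linarith
  · rw [add_dotProduct, smul_dotProduct, smul_eq_mul, htj]
    ring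
  · rw [add_dotProduct, smul_dotProduct, smul_eq_mul]
    rcases lt_or_ge 0 (u ⬝ᵥ toReal (a i)) with hi | hi
    · have := (le_div_iff₀ hi).1 (hmin i hi)
      linarith
    · have := mul_nonpos_of_nonneg_of_nonpos ht0 hi
      linarith [hz i]

/-- The cone generated by the `𝔞_j`. -/
def InCone (a : Fin N → Fin n → ℤ) (w : Fin n → ℝ) : Prop :=
  ∃ μ : Fin N → ℝ, (∀ j, 0 ≤ μ j) ∧ ∑ j, μ j • toReal (a j) = w

namespace IsVertexSystem

variable {d : Fin N → ℝ} {y : (Fin n ↪o Fin N) → Fin n → ℝ}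

theorem eq_of_y_eq (hv : IsVertexSystem a T d y) {I J : Fin n ↪o Fin N} (hI : I ∈ T) (hJ : J ∈ T)
    (h : y I = y J) : I = J := by
  have hr : Set.range I = Set.range J := by
    ext j
    rw [← hv.eq_iff I hI, ← hv.eq_iff J hJ, h]
  exact OrderEmbedding.range_inj.1 hr

/-- Expand `w` in the basis $I$. For feasible `z` the second factors are slacks, hence nonnegative,
so the signs of the coordinates of `w` control the comparison of `y I` with `z`. -/
theorem sub_dotProduct_eq (hv : IsVertexSystem a T d y) {I : Fin n ↪o Fin N} (hI : I ∈ T)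
    (z w : Fin n → ℝ) :
    (y I - z) ⬝ᵥ w = ∑ k, coords a I w k * (d (I k) - z ⬝ᵥ toReal (a (I k))) := by
  conv_lhs => rw [← sum_coords (hv.indep I hI) w]
  rw [dotProduct_sum]
  refine Finset.sum_congr rfl fun k _ => ?_
  rw [dotProduct_smul, sub_dotProduct, (hv.eq_iff I hI _).2 ⟨k, rfl⟩, smul_eq_mul]

/-- If a coordinate of a point `w` of the cone with respect to `I` is negative, then exchanging the
corresponding vertex of `I` leads to a simplex with greater value at `w`. -/
theorem exists_pivot (hv : IsVertexSystem a T d y) {w : Fin n → ℝ} (hw : InCone a w)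
    {I : Fin n ↪o Fin N} (hI : I ∈ T) {k : Fin n} (hk : coords a I w k < 0) :
    ∃ J ∈ T, (∀ l ≠ k, I l ∈ Set.range J) ∧ y I ⬝ᵥ w < y J ⬝ᵥ w := by
  have hind := hv.indep I hI
  -- The edge direction of the polyhedron at `y I` that releases constraint `I k` and keeps the
  -- other constraints of `I` tight.
  set u : Fin n → ℝ := -(colMatrix a I)⁻¹ k with hu
  have hul : ∀ l, u ⬝ᵥ toReal (a (I l)) = if k = l then -1 else 0 := fun l => by
    rw [hu, neg_dotProduct, inv_colMatrix_dotProduct hind]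
    split_ifs <;> simp
  have huw : 0 < u ⬝ᵥ w := by
    rw [hu, neg_dotProduct]
    exact neg_pos.2 hk
  -- The edge is bounded: `w` lies in the cone of the $\mathfrak a_j$, so they cannot all pair
  -- nonpositively with `u`.
  have hex : ∃ j, 0 < u ⬝ᵥ toReal (a j) := by
    by_contra! hcon
    obtain ⟨μ, hμ, rfl⟩ := hw
    rw [dotProduct_sum] at huw
    refine huw.not_ge (Finset.sum_nonpos fun j _ => ?_)
    rw [dotProduct_smul]
    exact mul_nonpos_of_nonneg_of_nonpos (hμ j) (hcon j)
  obtain ⟨t, j, ht, huj, ht0, hj, hle⟩ := exists_ratio d (hv.le I hI) hex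
  -- A step of length zero would meet a constraint already tight at `y I`, hence one in `I`, and on
  -- those `u` is nonpositive.
  have htpos : 0 < t := by
    refine lt_of_le_of_ne ht fun h => ?_
    obtain ⟨l, rfl⟩ := (hv.eq_iff I hI j).1 (ht0 h.symm)
    rw [hul] at huj
    split_ifs at huj <;> linarith
  have hne : ∀ l ≠ k, Function.update I k j l = I l := fun l hl => Function.update_of_ne hl _ _
  have hf : LinearIndependent ℝ fun l => toReal (a (Function.update I k j l)) := by
    rw [Fintype.linearIndependent_iff]
    intro g hg
    -- Pairing a linear relation with `u` isolates the coefficient of the entering vector.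
    have hsplit : ∑ l, g l • (u ⬝ᵥ toReal (a (Function.update I k j l))) = 0 := by
      have := congrArg (fun v => u ⬝ᵥ v) hg
      simpa only [dotProduct_sum, dotProduct_smul, dotProduct_zero] using this
    rw [Finset.sum_eq_single k (fun l _ hl => by rw [hne l hl, hul, if_neg hl.symm, smul_zero])
      (by simp), Function.update_self, smul_eq_mul, mul_eq_zero, or_iff_left huj.ne'] at hsplit
    refine Fintype.linearIndependent_iff.1 hind g ?_
    rw [← hg]
    refine Finset.sum_congr rfl fun l _ => ?_
    by_cases hl : l = k
    · rw [hl, hsplit, zero_smul, zero_smul]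
    · rw [hne l hl]
  obtain ⟨J, hJ, hrange, hyJ⟩ := hv.complete _ (y I + t • u) hf (fun l => by
    by_cases hl : l = k
    · rw [hl, Function.update_self, hj]
    · rw [hne l hl, add_dotProduct, smul_dotProduct, hul, if_neg (Ne.symm hl),
        (hv.eq_iff I hI _).2 ⟨l, rfl⟩, smul_zero, add_zero]) hle
  refine ⟨J, hJ, fun l hl => ?_, ?_⟩
  · rw [hrange, ← hne l hl]
    exact Set.mem_range_self l
  · rw [hyJ, add_dotProduct, smul_dotProduct, smul_eq_mul]
    linarith [mul_pos htpos huw]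

/-- The origin is feasible since all $d_j>0$. From there, move orthogonally to the tight vectors
found so far until a new constraint becomes tight; after $n$ rounds the point is a vertex. The
spanning hypothesis guarantees that a constraint is met. -/
theorem nonempty (hv : IsVertexSystem a T d y)
    (hspan : ∀ u : Fin n → ℝ, (∀ j, u ⬝ᵥ toReal (a j) = 0) → u = 0) : T.Nonempty := by
  have key : ∀ m ≤ n, ∃ (g : Fin m → Fin N) (z : Fin n → ℝ),
      (LinearIndependent ℝ fun k => toReal (a (g k))) ∧
      (∀ k, z ⬝ᵥ toReal (a (g k)) = d (g k)) ∧ ∀ j, z ⬝ᵥ toReal (a j) ≤ d j := by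
    intro m
    induction m with
    | zero =>
      exact fun _ => ⟨Fin.elim0, 0, linearIndependent_empty_type, fun k => k.elim0,
        fun j => by simpa using (hv.pos j).le⟩
    | succ m ih =>
      intro hm
      obtain ⟨g, z, hg, hz, hle⟩ := ih (by omega)
      obtain ⟨u, hu0, hu⟩ : ∃ u : Fin n → ℝ, u ≠ 0 ∧ ∀ k, u ⬝ᵥ toReal (a (g k)) = 0 := by
        have hker := LinearMap.ker_ne_bot_of_finrank_lt
          (f := (Matrix.of fun k => toReal (a (g k)) : Matrix (Fin m) (Fin n) ℝ).mulVecLin)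
          (by simpa using hm)
        obtain ⟨u, hu, hu0⟩ := Submodule.exists_mem_ne_zero_of_ne_bot hker
        refine ⟨u, hu0, fun k => ?_⟩
        rw [dotProduct_comm]
        exact congrFun (LinearMap.mem_ker.1 hu) k
      obtain ⟨v, hv0, hvj⟩ : ∃ v : Fin n → ℝ, (∀ k, v ⬝ᵥ toReal (a (g k)) = 0) ∧
          ∃ j, 0 < v ⬝ᵥ toReal (a j) := by
        -- One of `u` and `-u` works, since otherwise `u` would be orthogonal to every $\mathfrak
        -- a_j$.
        by_contra! hcon
        refine hu0 (hspan u fun j => le_antisymm (hcon u hu j) ?_)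
        have := hcon (-u) (fun k => by rw [neg_dotProduct, hu, neg_zero]) j
        rw [neg_dotProduct] at this
        linarith
      obtain ⟨t, j, -, hj, -, hjt, hle'⟩ := exists_ratio d hle hvj
      have hcomp : (fun k => toReal (a (Fin.snoc (α := fun _ => Fin N) g j k))) =
          Fin.snoc (α := fun _ => Fin n → ℝ) (fun k => toReal (a (g k))) (toReal (a j)) := by
        funext k
        refine Fin.lastCases ?_ (fun k => ?_) k <;> simp
      refine ⟨Fin.snoc g j, z + t • v, ?_, fun k => ?_, hle'⟩
      · rw [hcomp, linearIndependent_finSnoc]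
        refine ⟨hg, fun hmem => hj.ne' ?_⟩
        refine Submodule.span_induction (p := fun x _ => v ⬝ᵥ x = 0) ?_ ?_ ?_ ?_ hmem
        · rintro _ ⟨k, rfl⟩
          exact hv0 k
        · exact dotProduct_zero v
        · intro x x' _ _ hx hx'
          rw [dotProduct_add, hx, hx', add_zero]
        · intro s x _ hx
          rw [dotProduct_smul, hx, smul_zero]
      · refine Fin.lastCases ?_ (fun k => ?_) k
        · simpa using hjt
        · simp [add_dotProduct, smul_dotProduct, hv0, hz]
  obtain ⟨g, z, hg, hz, hle⟩ := key n le_rfl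
  obtain ⟨I, hI, -⟩ := hv.complete g z hg hz hle
  exact ⟨I, hI⟩

/-- The cones over the simplices of the triangulation cover the cone over `Δ`. -/
theorem exists_coords_nonneg (hv : IsVertexSystem a T d y) (hT : T.Nonempty) {w : Fin n → ℝ}
    (hw : InCone a w) : ∃ I ∈ T, ∀ k, 0 ≤ coords a I w k := by
  obtain ⟨I, hI, hmax⟩ := T.exists_max_image (fun I => y I ⬝ᵥ w) hT
  refine ⟨I, hI, fun k => ?_⟩
  by_contra! hk
  obtain ⟨J, hJ, -, hlt⟩ := hv.exists_pivot hw hI hk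
  exact (hmax J hJ).not_gt hlt

end IsVertexSystem

/-- Take $w=\sum_j t^j\mathfrak a_j$ with $t>0$. Its coordinate at `I k` is a polynomial in $t$
whose coefficient at the exponent `I k` is $1$, so only finitely many $t$ are excluded. -/
theorem exists_generic_point (hI : ∀ I ∈ T, IndepAt a I) :
    ∃ w, InCone a w ∧ ∀ I ∈ T, ∀ k, coords a I w k ≠ 0 := by
  let p : (Fin n ↪o Fin N) → Fin n → Polynomial ℝ := fun I k =>
    ∑ j : Fin N, Polynomial.C (coords a I (toReal (a j)) k) * Polynomial.X ^ (j : ℕ)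
  have hp : ∀ I ∈ T, ∀ k, p I k ≠ 0 := by
    intro I hIT k h
    have hc := congrArg (fun q => Polynomial.coeff q (I k : ℕ)) h
    simp only [p, Polynomial.finsetSum_coeff, Polynomial.coeff_C_mul, Polynomial.coeff_X_pow,
      Polynomial.coeff_zero, Fin.val_inj] at hc
    rw [Finset.sum_eq_single (I k) (fun j _ hj => by rw [if_neg (Ne.symm hj), mul_zero]) (by simp),
      if_pos rfl, mul_one] at hc
    have h1 : coords a I (toReal (a (I k))) k = 1 := by
      have := inv_colMatrix_dotProduct (hI I hIT) k k
      rwa [if_pos rfl] at this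
    linarith
  have hq : (∏ I ∈ T, ∏ k, p I k) ≠ 0 :=
    Finset.prod_ne_zero_iff.2 fun I hIT => Finset.prod_ne_zero_iff.2 fun k _ => hp I hIT k
  obtain ⟨t, ht, hroot⟩ := (Set.Ioi_infinite (0 : ℝ)).exists_notMem_finset
    (∏ I ∈ T, ∏ k, p I k).roots.toFinset
  rw [Multiset.mem_toFinset, Polynomial.mem_roots hq, Polynomial.IsRoot, Polynomial.eval_prod,
    Finset.prod_eq_zero_iff] at hroot
  refine ⟨∑ j : Fin N, t ^ (j : ℕ) • toReal (a j), ⟨fun j => t ^ (j : ℕ),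
    fun j => pow_nonneg (le_of_lt ht) _, rfl⟩, fun I hIT k h => hroot ⟨I, hIT, ?_⟩⟩
  rw [Polynomial.eval_prod]
  refine Finset.prod_eq_zero (Finset.mem_univ k) ?_
  rw [← h]
  simp only [p, coords, Matrix.mulVec_sum, Matrix.mulVec_smul, Polynomial.eval_finsetSum,
    Polynomial.eval_mul, Polynomial.eval_C, Polynomial.eval_pow, Polynomial.eval_X,
    Finset.sum_apply, Pi.smul_apply, smul_eq_mul]
  exact Finset.sum_congr rfl fun j _ => mul_comm _ _

/-- A shelling of the triangulation: simplices are shelled by decreasing `h`, and `η I` is the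
minimal new face of `I`. -/
structure IsShelling (T : Finset (Fin n ↪o Fin N)) (h : (Fin n ↪o Fin N) → ℝ)
    (η : (Fin n ↪o Fin N) → Finset (Fin N)) : Prop where
  subset_range : ∀ I ∈ T, (η I : Set (Fin N)) ⊆ Set.range I
  lt : ∀ I ∈ T, ∀ J ∈ T, (η I : Set (Fin N)) ⊆ Set.range J → J ≠ I → h J < h I
  exists_between : ∀ F, IsSimplex T F → ∃ I ∈ T, (F : Set (Fin N)) ⊆ Set.range I ∧ η I ⊆ F

/-- A line shelling: order by the value of `y I` at a generic `w`, and let `η I` record the negative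
coordinates of `w`. -/
theorem IsVertexSystem.exists_isShelling {d : Fin N → ℝ} {y : (Fin n ↪o Fin N) → Fin n → ℝ}
    (hv : IsVertexSystem a T d y) : ∃ h η, IsShelling T h η := by
  classical
  obtain ⟨w, hw, hgen⟩ := exists_generic_point hv.indep
  refine ⟨fun I => y I ⬝ᵥ w,
    fun I => (Finset.univ.filter fun k => coords a I w k < 0).image I, ?_, ?_, ?_⟩
  · intro I _ j hj
    simp only [Finset.coe_image] at hj
    exact Set.image_subset_range _ _ hj
  · intro I hI J hJ hsub hne
    -- Negative coordinates occur only at vertices in `η I`, which lie in `J`, where the slack of `y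
    -- J` is zero.
    have hnn : ∀ k, 0 ≤ coords a I w k * (d (I k) - y J ⬝ᵥ toReal (a (I k))) := by
      intro k
      rcases lt_or_ge (coords a I w k) 0 with hk | hk
      · have hmem : I k ∈ Set.range J := hsub (by simpa using hk)
        rw [(hv.eq_iff J hJ _).2 hmem, sub_self, mul_zero]
      · exact mul_nonneg hk (sub_nonneg.2 (hv.le J hJ _))
    have hsum := hv.sub_dotProduct_eq hI (y J) w
    refine lt_of_le_of_ne ?_ fun heq => hne ?_
    · have := Finset.sum_nonneg fun k (_ : k ∈ Finset.univ) => hnn k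
      rw [← hsum, sub_dotProduct] at this
      linarith
    · rw [sub_dotProduct, heq, sub_self, eq_comm,
        Finset.sum_eq_zero_iff_of_nonneg fun k _ => hnn k] at hsum
      refine hv.eq_of_y_eq hJ hI (eq_of_dotProduct_eq (hv.indep I hI) fun k => ?_)
      have := (mul_eq_zero.1 (hsum k (Finset.mem_univ k))).resolve_left (hgen I hI k)
      rw [(hv.eq_iff I hI _).2 ⟨k, rfl⟩]
      linarith
  · rintro F ⟨I₀, hI₀, hF₀⟩
    obtain ⟨I, hI, hmax⟩ := (T.filter fun I : Fin n ↪o Fin N => (F : Set (Fin N)) ⊆ Set.range I).exists_max_image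
      (fun I => y I ⬝ᵥ w) ⟨I₀, Finset.mem_filter.2 ⟨hI₀, hF₀⟩⟩
    simp only [Finset.mem_filter] at hI hmax
    refine ⟨I, hI.1, hI.2, fun j hj => ?_⟩
    simp only [Finset.mem_image, Finset.mem_filter, Finset.mem_univ, true_and] at hj
    obtain ⟨k, hk, rfl⟩ := hj
    -- Pivoting away a vertex outside `F` would give a simplex still containing `F` with a greater
    -- value.
    by_contra hkF
    obtain ⟨J, hJ, hIJ, hlt⟩ := hv.exists_pivot hw hI.1 hk
    refine (hmax J ⟨hJ, fun i hi => ?_⟩).not_gt hlt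
    obtain ⟨l, rfl⟩ := hI.2 hi
    exact hIJ l fun hlk => hkF (hlk ▸ hi)

end

end GKZ

/-! ### The normalized volume -/

namespace GKZ

noncomputable section

open Matrix MeasureTheory

variable {n N : ℕ} {a : Fin N → Fin n → ℤ} {T : Finset (Fin n ↪o Fin N)}

theorem volume_hyperplane {u : Fin n → ℝ} (hu : u ≠ 0) :
    volume {x : Fin n → ℝ | u ⬝ᵥ x = 0} = 0 := by
  have h := Measure.addHaar_submodule (volume : Measure (Fin n → ℝ))
    (LinearMap.ker (dotProductBilin ℝ ℝ u)) (fun htop => hu ?_)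
  · exact h
  · have : u ⬝ᵥ u = 0 := by
      have hmem : u ∈ LinearMap.ker (dotProductBilin ℝ ℝ u) := htop ▸ Submodule.mem_top
      exact hmem
    exact dotProduct_self_eq_zero.1 this

/-- The simplex spanned by `0` and the unit vectors. -/
def cornerSimplex (n : ℕ) : Set (Fin n → ℝ) := {x | (∀ k, 0 ≤ x k) ∧ ∑ k, x k ≤ 1}

theorem isCompact_cornerSimplex : IsCompact (cornerSimplex n) := by
  refine (isCompact_Icc (a := (0 : Fin n → ℝ)) (b := 1)).of_isClosed_subset ?_ ?_
  · have h1 : IsClosed {x : Fin n → ℝ | ∀ k, 0 ≤ x k} := by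
      simp only [Set.ofPred_forall]
      exact isClosed_iInter fun k => isClosed_le continuous_const (continuous_apply k)
    have h2 : Continuous fun x : Fin n → ℝ => ∑ k, x k := by fun_prop
    exact h1.inter (isClosed_le h2 continuous_const)
  · rintro x ⟨hx, hs⟩
    refine ⟨hx, fun k => ?_⟩
    exact (Finset.single_le_sum (fun l _ => hx l) (Finset.mem_univ k)).trans hs

theorem measurableSet_image_cornerSimplex (M : Matrix (Fin n) (Fin n) ℝ) :
    MeasurableSet (Matrix.toLin' M '' cornerSimplex n) :=
  (isCompact_cornerSimplex.image (LinearMap.continuous_of_finiteDimensional _)).measurableSet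

theorem volume_image_cornerSimplex {M : Matrix (Fin n) (Fin n) ℝ} (hM : |M.det| = 1) :
    volume (Matrix.toLin' M '' cornerSimplex n) = volume (cornerSimplex n) := by
  rw [Measure.addHaar_image_linearMap, LinearMap.det_toLin', hM, ENNReal.ofReal_one, one_mul]

/-- The $\ell^1$ unit ball has volume $2^n/n!$ and is the union of the $2^n$ reflections of the
corner simplex, which overlap inside coordinate hyperplanes. -/
theorem volume_cornerSimplex (hn : 0 < n) :
    (n ! : ENNReal) * volume (cornerSimplex n) = 1 := by
  have : Nonempty (Fin n) := ⟨⟨0, hn⟩⟩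
  let D : (Fin n → ℤˣ) → Matrix (Fin n) (Fin n) ℝ := fun s =>
    Matrix.diagonal fun k => ((s k : ℤ) : ℝ)
  have habs : ∀ u : ℤˣ, |((u : ℤ) : ℝ)| = 1 := fun u => by
    rcases Int.units_eq_one_or u with rfl | rfl <;> simp
  have hD : ∀ s, |(D s).det| = 1 := fun s => by
    simp [D, Matrix.det_diagonal, Finset.abs_prod, habs]
  have hDx : ∀ s x k, Matrix.toLin' (D s) x k = ((s k : ℤ) : ℝ) * x k := fun s x k => by
    simp [D, Matrix.mulVec_diagonal]
  have hunion : {x : Fin n → ℝ | (∑ i, |x i| ^ (1 : ℝ)) ^ (1 / (1 : ℝ)) ≤ 1} =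
      ⋃ s ∈ (Finset.univ : Finset (Fin n → ℤˣ)), Matrix.toLin' (D s) '' cornerSimplex n := by
    ext x
    simp only [Real.rpow_one, one_div, inv_one, Set.mem_ofPred_eq, Set.mem_iUnion, Finset.mem_univ,
      exists_const, Set.mem_image]
    constructor
    · intro hx
      refine ⟨fun k => if 0 ≤ x k then 1 else -1, fun k => |x k|, ⟨fun k => abs_nonneg _, hx⟩, ?_⟩
      ext k
      rw [hDx]
      split_ifs with h
      · simp [abs_of_nonneg h]
      · simp [abs_of_neg (not_le.1 h)]
    · rintro ⟨s, z, ⟨hz, hs⟩, rfl⟩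
      simp only [hDx, abs_mul, habs, one_mul]
      rwa [Finset.sum_congr rfl fun k _ => abs_of_nonneg (hz k)]
  have hball := volume_sum_rpow_le (Fin n) (p := 1) le_rfl 1
  rw [hunion, measure_biUnion_finset₀] at hball
  · simp only [volume_image_cornerSimplex (hD _), Finset.sum_const, Finset.card_univ,
      Fintype.card_fun, Fintype.card_units_int, Fintype.card_fin, nsmul_eq_mul, Nat.cast_pow,
      Nat.cast_ofNat, ENNReal.ofReal_one, one_pow, one_mul, div_one, Real.Gamma_nat_eq_factorial]
      at hball
    have hG : Real.Gamma (1 + 1) = 1 := by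
      simpa using Real.Gamma_nat_eq_factorial 1
    rw [hG, mul_one, ENNReal.ofReal_div_of_pos (by positivity), ENNReal.ofReal_pow (by norm_num),
      ENNReal.ofReal_natCast, ENNReal.ofReal_ofNat, div_eq_mul_inv] at hball
    rw [(ENNReal.mul_right_inj (by simp) (by simp)).1 hball]
    exact ENNReal.mul_inv_cancel (by positivity) (by simp)
  · intro s _ t _ hst
    obtain ⟨k, hk⟩ := Function.ne_iff.1 hst
    refine measure_mono_null ?_ (volume_hyperplane (u := Pi.single k 1) (by simp))
    rintro _ ⟨⟨x, ⟨hx, -⟩, rfl⟩, ⟨z, ⟨hz, -⟩, hxz⟩⟩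
    have h := congrFun hxz k
    rw [hDx, hDx] at h
    rw [Set.mem_ofPred_eq, single_one_dotProduct, hDx]
    have h1 := hx k
    have h2 := hz k
    have h0 : x k = 0 := by
      rcases Int.units_eq_one_or (s k) with hs | hs <;>
        rcases Int.units_eq_one_or (t k) with ht | ht <;> rw [hs, ht] at hk h
      · exact absurd rfl hk
      · simp only [Units.val_neg, Units.val_one, Int.cast_neg, Int.cast_one] at h
        linarith
      · simp only [Units.val_neg, Units.val_one, Int.cast_neg, Int.cast_one] at h
        linarith
      · exact absurd rfl hk
    rw [h0, mul_zero]
  · exact fun s _ => (measurableSet_image_cornerSimplex _).nullMeasurableSet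

theorem IsUnimodular.abs_det_colMatrix (huni : IsUnimodular a T) {I : Fin n ↪o Fin N}
    (hI : I ∈ T) : |(colMatrix a I).det| = 1 := by
  have h : colMatrix a I = (Int.castRingHom ℝ).mapMatrix (Matrix.of fun r k : Fin n => a (I k) r) :=
    rfl
  have := huni I hI
  rw [simplexVolume] at this
  rw [h, ← RingHom.map_det, eq_intCast, ← Int.cast_abs, this, Int.cast_one]

theorem toReal_dotProduct (x z : Fin n → ℤ) : toReal x ⬝ᵥ toReal z = ((x ⬝ᵥ z : ℤ) : ℝ) := by
  simp [toReal, dotProduct]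

/-- The pyramid over `Δ` with apex `0` consists of the nonnegative combinations of the `𝔞_j` with
coefficient sum at most `1`. -/
theorem mem_convexHull_insert_zero_polytope {x : Fin n → ℝ} :
    x ∈ convexHull ℝ (insert 0 (polytope a)) ↔
      ∃ μ : Fin N → ℝ, (∀ j, 0 ≤ μ j) ∧ ∑ j, μ j ≤ 1 ∧ ∑ j, μ j • toReal (a j) = x := by
  constructor
  · let S : Set (Fin n → ℝ) :=
      {x | ∃ μ : Fin N → ℝ, (∀ j, 0 ≤ μ j) ∧ ∑ j, μ j ≤ 1 ∧ ∑ j, μ j • toReal (a j) = x}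
    have hconv : Convex ℝ S := by
      rintro _ ⟨μ, hμ, hμs, rfl⟩ _ ⟨ν, hν, hνs, rfl⟩ s t hs ht hst
      refine ⟨fun j => s * μ j + t * ν j, fun j => by have := hμ j; have := hν j; positivity,
        ?_, ?_⟩
      · rw [Finset.sum_add_distrib, ← Finset.mul_sum, ← Finset.mul_sum]
        nlinarith
      · simp only [Finset.smul_sum, smul_smul, add_smul, Finset.sum_add_distrib]
    refine fun hx => convexHull_min (t := S) (Set.insert_subset ?_ (convexHull_min ?_ hconv)) hconv hx
    · exact ⟨0, fun _ => le_rfl, by simp, by simp⟩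
    · rintro _ ⟨j, rfl⟩
      classical
      refine ⟨Pi.single j 1, fun i => ?_, by simp, ?_⟩
      · rw [Pi.single_apply]
        split_ifs <;> norm_num
      · simp [Pi.single_apply, ite_smul]
  · rintro ⟨μ, hμ, hs, rfl⟩
    have h0 : (0 : Fin n → ℝ) ∈ convexHull ℝ (insert 0 (polytope a)) :=
      subset_convexHull _ _ (Set.mem_insert _ _)
    have hj : ∀ j, toReal (a j) ∈ convexHull ℝ (insert 0 (polytope a)) := fun j =>
      subset_convexHull _ _ (Set.mem_insert_of_mem _ (subset_convexHull _ _ ⟨j, rfl⟩))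
    have := (convex_convexHull ℝ (insert 0 (polytope a))).sum_mem (t := Finset.univ)
      (w := fun o : Option (Fin N) => o.elim (1 - ∑ j, μ j) μ)
      (z := fun o => o.elim 0 fun j => toReal (a j)) ?_ ?_ ?_
    · simpa [Fintype.sum_option] using this
    · rintro (_ | j) -
      · simpa using hs
      · exact hμ j
    · simp [Fintype.sum_option]
    · rintro (_ | j) -
      · exact h0
      · exact hj j

namespace IsVertexSystem

variable {d : Fin N → ℝ} {y : (Fin n ↪o Fin N) → Fin n → ℝ}

/-- The cones cover, and the bound on coefficient sums passes from one representation of $x$ to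
another because each sum equals $\mathfrak a_0^\vee\cdot x$. -/
theorem convexHull_insert_zero_polytope (hv : IsVertexSystem a T d y) (hT : T.Nonempty)
    (hcond : ∃ a₀ : Fin n → ℤ, ∀ i, a₀ ⬝ᵥ a i = 1) :
    convexHull ℝ (insert 0 (polytope a)) =
      ⋃ I ∈ T, Matrix.toLin' (colMatrix a I) '' cornerSimplex n := by
  obtain ⟨a₀, ha₀⟩ := hcond
  have hone : ∀ j, toReal a₀ ⬝ᵥ toReal (a j) = 1 := fun j => by
    rw [toReal_dotProduct, ha₀, Int.cast_one]
  ext x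
  simp only [mem_convexHull_insert_zero_polytope, Set.mem_iUnion, Set.mem_image, exists_prop]
  constructor
  · rintro ⟨μ, hμ, hs, hx⟩
    obtain ⟨I, hI, hnn⟩ := hv.exists_coords_nonneg hT ⟨μ, hμ, hx⟩
    have hc := sum_coords (hv.indep I hI) x
    refine ⟨I, hI, coords a I x, ⟨hnn, ?_⟩, by rw [Matrix.toLin'_apply, colMatrix_mulVec, hc]⟩
    have h1 := congrArg (toReal a₀ ⬝ᵥ ·) hc
    have h2 := congrArg (toReal a₀ ⬝ᵥ ·) hx
    simp only [dotProduct_sum, dotProduct_smul, hone, smul_eq_mul, mul_one] at h1 h2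
    rw [h1, ← h2]
    exact hs
  · rintro ⟨I, hI, z, ⟨hz, hs⟩, rfl⟩
    refine ⟨Function.extend I z 0, fun j => ?_, ?_, ?_⟩
    · by_cases hj : ∃ k, I k = j
      · obtain ⟨k, rfl⟩ := hj
        rw [I.injective.extend_apply]
        exact hz k
      · rw [Function.extend_apply' _ _ _ hj, Pi.zero_apply]
    · rwa [← Finset.sum_subset (Finset.subset_univ (Finset.univ.map I.toEmbedding)) fun j _ hj => ?_,
        Finset.sum_map, Finset.sum_congr rfl fun k _ =>
          show Function.extend I z 0 (I.toEmbedding k) = z k from I.injective.extend_apply z 0 k]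
      rw [Function.extend_apply' _ _ _ (by simpa using hj), Pi.zero_apply]
    · rw [Matrix.toLin'_apply, colMatrix_mulVec,
        ← Finset.sum_subset (Finset.subset_univ (Finset.univ.map I.toEmbedding)) fun j _ hj => ?_,
        Finset.sum_map]
      · exact Finset.sum_congr rfl fun k _ => by
          rw [RelEmbedding.coe_toEmbedding, I.injective.extend_apply]
      · rw [Function.extend_apply' _ _ _ (by simpa using hj), Pi.zero_apply, zero_smul]

/-- The functional `y I - y J` is nonnegative on the first simplex and nonpositive on the second, so
they meet inside a hyperplane. -/
theorem aedisjoint (hv : IsVertexSystem a T d y) {I J : Fin n ↪o Fin N} (hI : I ∈ T) (hJ : J ∈ T)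
    (hne : I ≠ J) : AEDisjoint volume (Matrix.toLin' (colMatrix a I) '' cornerSimplex n)
      (Matrix.toLin' (colMatrix a J) '' cornerSimplex n) := by
  have key : ∀ I ∈ T, ∀ J ∈ T, ∀ x ∈ Matrix.toLin' (colMatrix a I) '' cornerSimplex n,
      0 ≤ (y I - y J) ⬝ᵥ x := by
    rintro I hI J hJ _ ⟨z, ⟨hz, -⟩, rfl⟩
    rw [Matrix.toLin'_apply, colMatrix_mulVec, dotProduct_sum]
    refine Finset.sum_nonneg fun k _ => ?_
    rw [dotProduct_smul, sub_dotProduct, (hv.eq_iff I hI _).2 ⟨k, rfl⟩]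
    exact mul_nonneg (hz k) (sub_nonneg.2 (hv.le J hJ _))
  refine measure_mono_null ?_
    (volume_hyperplane (sub_ne_zero.2 fun h => hne (hv.eq_of_y_eq hI hJ h)))
  rintro x ⟨hxI, hxJ⟩
  have h1 := key I hI J hJ x hxI
  have h2 := key J hJ I hI x hxJ
  rw [← neg_sub, neg_dotProduct] at h2
  exact le_antisymm (by linarith) h1

theorem normalizedVolume_polytope (hv : IsVertexSystem a T d y) (hT : T.Nonempty) (hn : 0 < n)
    (hcond : ∃ a₀ : Fin n → ℤ, ∀ i, a₀ ⬝ᵥ a i = 1) (huni : IsUnimodular a T) :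
    normalizedVolume (polytope a) = T.card := by
  have hvol : volume (convexHull ℝ (insert 0 (polytope a))) =
      T.card * volume (cornerSimplex n) := by
    rw [hv.convexHull_insert_zero_polytope hT hcond, measure_biUnion_finset₀
      (fun I hI J hJ hne => hv.aedisjoint hI hJ hne)
      (fun I _ => (measurableSet_image_cornerSimplex _).nullMeasurableSet),
      Finset.sum_congr rfl fun I hI => volume_image_cornerSimplex (huni.abs_det_colMatrix hI),
      Finset.sum_const, nsmul_eq_mul]
  have h := congrArg (fun v => ((n ! : ENNReal) * v).toReal) hvol
  rw [mul_left_comm (n ! : ENNReal), volume_cornerSimplex hn, mul_one, ENNReal.toReal_mul, ENNReal.toReal_natCast,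
    ENNReal.toReal_natCast] at h
  exact h

end IsVertexSystem

end

end GKZ

/-! ### The Stanley–Reisner ring over the polynomial ring in the linear forms -/

namespace GKZ

noncomputable section

open MvPolynomial

variable {n N : ℕ} {a : Fin N → Fin n → ℤ} {T : Finset (Fin n ↪o Fin N)}

/-- The integer matrix with columns `𝔞_i`, `i ∈ I`. -/
def simplexMatrix (a : Fin N → Fin n → ℤ) (I : Fin n ↪o Fin N) : Matrix (Fin n) (Fin n) ℤ :=
  Matrix.of fun r k => a (I k) r

theorem IsUnimodular.isUnit_det (huni : IsUnimodular a T) {I : Fin n ↪o Fin N} (hI : I ∈ T) :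
    IsUnit (simplexMatrix a I).det :=
  Int.isUnit_iff_abs_eq.2 (huni I hI)

theorem sum_inv_mul_simplexMatrix {I : Fin n ↪o Fin N} (hI : IsUnit (simplexMatrix a I).det)
    (k l : Fin n) : ∑ r, (simplexMatrix a I)⁻¹ k r * a (I l) r = if k = l then 1 else 0 := by
  rw [← Matrix.one_apply, ← Matrix.nonsing_inv_mul _ hI, Matrix.mul_apply]
  rfl

theorem sum_simplexMatrix_mul_inv {I : Fin n ↪o Fin N} (hI : IsUnit (simplexMatrix a I).det)
    (r s : Fin n) : ∑ k, a (I k) r * (simplexMatrix a I)⁻¹ k s = if r = s then 1 else 0 := by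
  rw [← Matrix.one_apply, ← Matrix.mul_nonsing_inv _ hI, Matrix.mul_apply]
  rfl

section Coefficients

variable (K : Type*) [CommRing K]

/-- The linear form `a_{r1} C₁ + ⋯ + a_{rN} C_N`. -/
def linearForm (a : Fin N → Fin n → ℤ) (r : Fin n) : MvPolynomial (Fin N) K :=
  ∑ j : Fin N, C ((a j r : ℤ) : K) * X j

/-- The Stanley–Reisner ideal. -/
def nonfaceIdeal (T : Finset (Fin n ↪o Fin N)) : Ideal (MvPolynomial (Fin N) K) :=
  Ideal.span {p | ∃ F : Finset (Fin N), ¬ IsSimplex T F ∧ p = ∏ i ∈ F, X i}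

/-- The substitution of the linear forms. -/
def substForms (a : Fin N → Fin n → ℤ) :
    MvPolynomial (Fin n) K →ₐ[K] MvPolynomial (Fin N) K :=
  aeval (linearForm K a)

/-- The `k`-th coordinate with respect to `I`, as a linear form. -/
def dualForm (a : Fin N → Fin n → ℤ) (I : Fin n ↪o Fin N) (k : Fin n) : MvPolynomial (Fin n) K :=
  ∑ r, C (((simplexMatrix a I)⁻¹ k r : ℤ) : K) * X r

/-- The restriction of the Stanley–Reisner ring to the simplex `I`. -/
def restrictSimplex (a : Fin N → Fin n → ℤ) (I : Fin n ↪o Fin N) :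
    MvPolynomial (Fin N) K →ₐ[K] MvPolynomial (Fin n) K :=
  aeval (Function.extend I (dualForm K a I) 0)

variable {K}

theorem restrictSimplex_X_apply (I : Fin n ↪o Fin N) (k : Fin n) :
    restrictSimplex K a I (X (I k)) = dualForm K a I k := by
  rw [restrictSimplex, aeval_X, I.injective.extend_apply]

theorem restrictSimplex_X_of_notMem {I : Fin n ↪o Fin N} {j : Fin N} (hj : j ∉ Set.range I) :
    restrictSimplex K a I (X j) = 0 := by
  rw [restrictSimplex, aeval_X, Function.extend_apply' _ _ _ hj, Pi.zero_apply]

theorem sum_univ_eq_of_range {M : Type*} [AddCommMonoid M] (I : Fin n ↪o Fin N) {f : Fin N → M}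
    (hf : ∀ j ∉ Set.range I, f j = 0) : ∑ j, f j = ∑ k, f (I k) := by
  rw [← Finset.sum_subset (Finset.subset_univ (Finset.univ.map I.toEmbedding)) fun j _ hj =>
    hf j (by simpa using hj), Finset.sum_map]
  rfl

theorem restrictSimplex_linearForm {I : Fin n ↪o Fin N} (hI : IsUnit (simplexMatrix a I).det)
    (r : Fin n) : restrictSimplex K a I (linearForm K a r) = X r := by
  simp only [linearForm, map_sum, map_mul, algHom_C, algebraMap_eq]
  rw [sum_univ_eq_of_range I fun j hj => by rw [restrictSimplex_X_of_notMem hj, mul_zero]]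
  simp only [restrictSimplex_X_apply, dualForm, Finset.mul_sum, ← mul_assoc, ← C_mul]
  rw [Finset.sum_comm]
  simp only [← Finset.sum_mul, ← map_sum, ← Int.cast_mul, ← Int.cast_sum,
    sum_simplexMatrix_mul_inv hI]
  simp

/-- Restriction to a single simplex loses nothing of a coefficient that is a polynomial in the
linear forms. -/
theorem restrictSimplex_substForms {I : Fin n ↪o Fin N} (hI : IsUnit (simplexMatrix a I).det)
    (g : MvPolynomial (Fin n) K) : restrictSimplex K a I (substForms K a g) = g := by
  have : (restrictSimplex K a I).comp (substForms K a) = AlgHom.id K _ := by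
    ext r : 1
    simp [substForms, restrictSimplex_linearForm hI]
  exact DFunLike.congr_fun this g

theorem restrictSimplex_prod_eq_zero {I : Fin n ↪o Fin N} {F : Finset (Fin N)}
    (hF : ¬ (F : Set (Fin N)) ⊆ Set.range I) : restrictSimplex K a I (∏ i ∈ F, X i) = 0 := by
  obtain ⟨j, hj, hjI⟩ := Set.not_subset.1 hF
  rw [map_prod]
  exact Finset.prod_eq_zero hj (restrictSimplex_X_of_notMem hjI)

theorem restrictSimplex_eq_zero_of_mem {I : Fin n ↪o Fin N} (hI : I ∈ T)
    {p : MvPolynomial (Fin N) K} (hp : p ∈ nonfaceIdeal K T) : restrictSimplex K a I p = 0 := by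
  have hle : nonfaceIdeal K T ≤ RingHom.ker (restrictSimplex K a I) := by
    refine Ideal.span_le.2 ?_
    rintro _ ⟨F, hF, rfl⟩
    exact restrictSimplex_prod_eq_zero fun hsub => hF ⟨I, hI, hsub⟩
  exact hle hp

/-- Each factor becomes a dual form, which is nonzero because it takes the value $1$ at its own
column $\mathfrak a_{I(k)}$. -/
theorem restrictSimplex_prod_ne_zero [IsDomain K] {I : Fin n ↪o Fin N}
    (hI : IsUnit (simplexMatrix a I).det) {F : Finset (Fin N)}
    (hF : (F : Set (Fin N)) ⊆ Set.range I) : restrictSimplex K a I (∏ i ∈ F, X i) ≠ 0 := by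
  rw [map_prod, Finset.prod_ne_zero_iff]
  intro i hi h
  obtain ⟨k, rfl⟩ := hF hi
  rw [restrictSimplex_X_apply] at h
  have h1 := congrArg (eval fun r => ((a (I k) r : ℤ) : K)) h
  simp only [dualForm, map_sum, map_mul, eval_C, eval_X, map_zero, ← Int.cast_mul,
    ← Int.cast_sum, sum_inv_mul_simplexMatrix hI] at h1
  simp at h1

/-- The straightening rule: a variable of `I` can be traded for a combination of the linear forms
and variables outside `I`. -/
theorem substForms_dualForm {I : Fin n ↪o Fin N} (hI : IsUnit (simplexMatrix a I).det)
    (k : Fin n) : substForms K a (dualForm K a I k) = X (I k) +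
      ∑ j ∈ Finset.univ.filter (· ∉ Set.range I),
        C ((∑ r, (simplexMatrix a I)⁻¹ k r * a j r : ℤ) : K) * X j := by
  have h : substForms K a (dualForm K a I k) =
      ∑ j, C ((∑ r, (simplexMatrix a I)⁻¹ k r * a j r : ℤ) : K) * X j := by
    simp only [substForms, dualForm, map_sum, map_mul, algHom_C, algebraMap_eq, aeval_X, linearForm,
      Finset.mul_sum]
    rw [Finset.sum_comm]
    refine Finset.sum_congr rfl fun j _ => ?_
    rw [Int.cast_sum, map_sum, Finset.sum_mul]
    refine Finset.sum_congr rfl fun r _ => ?_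
    rw [Int.cast_mul, map_mul, mul_assoc]
  rw [h, ← Finset.sum_filter_add_sum_filter_not Finset.univ (· ∈ Set.range I)]
  congr 1
  rw [Finset.sum_filter, sum_univ_eq_of_range I fun j hj => if_neg hj]
  simp only [Set.mem_range_self, if_true, sum_inv_mul_simplexMatrix hI]
  simp

theorem monomial_mem_nonfaceIdeal {m : Fin N →₀ ℕ} (hm : ¬ IsSimplex T m.support) :
    monomial m (1 : K) ∈ nonfaceIdeal K T := by
  have hle : ∑ i ∈ m.support, Finsupp.single i 1 ≤ m := by
    intro j
    rw [Finsupp.finsetSum_apply]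
    simp only [Finsupp.single_apply, Finset.sum_ite_eq', Finsupp.mem_support_iff]
    split_ifs <;> omega
  have hprod : ∏ i ∈ m.support, X i = monomial (∑ i ∈ m.support, Finsupp.single i 1) (1 : K) := by
    rw [monomial_sum_one]
    rfl
  rw [← add_tsub_cancel_of_le hle, ← one_mul (1 : K), ← monomial_mul, ← hprod]
  exact Ideal.mul_mem_right _ _ (Ideal.subset_span ⟨_, hm, rfl⟩)

/-- `p` is a combination of the monomials `∏ i ∈ η I, C_i`, with polynomials in the linear forms as
coefficients, modulo the Stanley–Reisner ideal. -/
def IsGenerated (a : Fin N → Fin n → ℤ) (T : Finset (Fin n ↪o Fin N))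
    (η : (Fin n ↪o Fin N) → Finset (Fin N)) (p : MvPolynomial (Fin N) K) : Prop :=
  ∃ g : (Fin n ↪o Fin N) → MvPolynomial (Fin n) K,
    p - ∑ I ∈ T, substForms K a (g I) * ∏ i ∈ η I, X i ∈ nonfaceIdeal K T

namespace IsGenerated

variable {η : (Fin n ↪o Fin N) → Finset (Fin N)} {p q : MvPolynomial (Fin N) K}

theorem of_mem (hp : p ∈ nonfaceIdeal K T) : IsGenerated a T η p :=
  ⟨0, by simpa using hp⟩

theorem prod {I : Fin n ↪o Fin N} (hI : I ∈ T) :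
    IsGenerated a T η (∏ i ∈ η I, X i : MvPolynomial (Fin N) K) := by
  classical
  refine ⟨Pi.single I 1, ?_⟩
  rw [Finset.sum_eq_single_of_mem I hI fun J _ hJ => by
    rw [Pi.single_eq_of_ne hJ, map_zero, zero_mul]]
  simp

theorem add (hp : IsGenerated a T η p) (hq : IsGenerated a T η q) :
    IsGenerated a T η (p + q) := by
  obtain ⟨g, hg⟩ := hp
  obtain ⟨g', hg'⟩ := hq
  refine ⟨g + g', ?_⟩
  convert Ideal.add_mem _ hg hg' using 1
  simp only [Pi.add_apply, map_add, add_mul, Finset.sum_add_distrib]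
  ring

theorem subst_mul (s : MvPolynomial (Fin n) K) (hp : IsGenerated a T η p) :
    IsGenerated a T η (substForms K a s * p) := by
  obtain ⟨g, hg⟩ := hp
  refine ⟨fun I => s * g I, ?_⟩
  convert Ideal.mul_mem_left _ (substForms K a s) hg using 1
  simp only [map_mul, mul_sub, Finset.mul_sum, mul_assoc]

theorem C_mul (x : K) (hp : IsGenerated a T η p) : IsGenerated a T η (C x * p) := by
  simpa [substForms, algHom_C] using hp.subst_mul (C x)

theorem sum {ι : Type*} (s : Finset ι) {f : ι → MvPolynomial (Fin N) K}
    (hf : ∀ i ∈ s, IsGenerated a T η (f i)) : IsGenerated a T η (∑ i ∈ s, f i) := by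
  classical
  induction s using Finset.induction_on with
  | empty => exact of_mem (by simp)
  | insert i s hi ih =>
    rw [Finset.sum_insert hi]
    exact (hf i (Finset.mem_insert_self i s)).add
      (ih fun j hj => hf j (Finset.mem_insert_of_mem hj))

end IsGenerated

namespace IsShelling

variable {h : (Fin n ↪o Fin N) → ℝ} {η : (Fin n ↪o Fin N) → Finset (Fin N)}

/-- Outer induction on the number of simplices with smaller `h`, inner induction on the degree.
Unless `m` is the basis monomial of `I`, split off a superfluous variable $C_{I(k)}$ and straighten
it. The linear form multiplies a monomial of lower degree for the same `I`; the remaining terms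
either are nonfaces or belong to simplices with smaller `h`. -/
theorem isGenerated_monomial_of_subset (hs : IsShelling T h η)
    (hdet : ∀ I ∈ T, IsUnit (simplexMatrix a I).det) (c : ℕ) :
    ∀ I ∈ T, (T.filter fun J => h J < h I).card = c → ∀ (e : ℕ) (m : Fin N →₀ ℕ),
      m.degree = e → η I ⊆ m.support → (m.support : Set (Fin N)) ⊆ Set.range I →
      IsGenerated a T η (monomial m (1 : K)) := by
  classical
  induction c using Nat.strong_induction_on with
  | _ c ihc =>
  intro I hI hc e
  induction e with
  | zero =>
    intro m hm hη _
    rw [Finsupp.degree_eq_zero_iff] at hm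
    subst hm
    have h0 : η I = ∅ := Finset.subset_empty.1 (by simpa using hη)
    have := IsGenerated.prod (K := K) (a := a) (η := η) hI
    rw [h0, Finset.prod_empty] at this
    exact this
  | succ e ihe =>
    intro m hm hη hmI
    by_cases heq : m = ∑ i ∈ η I, Finsupp.single i 1
    · have := IsGenerated.prod (K := K) (a := a) (η := η) hI
      rw [heq, monomial_sum_one]
      exact this
    -- The exponent dominates the indicator of `η I` and differs from it, so some variable can be
    -- removed with `η I` kept in the support.
    obtain ⟨i, hi⟩ : ∃ i, (if i ∈ η I then 1 else 0) < m i := by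
      by_contra! hcon
      refine heq (Finsupp.ext fun j => ?_)
      rw [Finsupp.finsetSum_apply]
      simp only [Finsupp.single_apply, Finset.sum_ite_eq']
      refine le_antisymm (hcon j) ?_
      split_ifs with hj
      · exact Nat.one_le_iff_ne_zero.2 (Finsupp.mem_support_iff.1 (hη hj))
      · exact Nat.zero_le _
    have him : i ∈ m.support := Finsupp.mem_support_iff.2 (by omega)
    obtain ⟨k, rfl⟩ := hmI him
    set m' := m - Finsupp.single (I k) 1 with hm'
    have hmm : m = m' + Finsupp.single (I k) 1 := by
      refine (tsub_add_cancel_of_le fun j => ?_).symm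
      rw [Finsupp.single_apply]
      split_ifs with hj
      · rw [← hj]
        omega
      · exact Nat.zero_le _
    have hdeg : m'.degree = e := by
      have := congrArg Finsupp.degree hmm
      rw [map_add, Finsupp.degree_single, hm] at this
      omega
    have hηm' : η I ⊆ m'.support := by
      intro j hj
      have hj0 := Finsupp.mem_support_iff.1 (hη hj)
      rw [Finsupp.mem_support_iff, hm', Finsupp.tsub_apply, Finsupp.single_apply]
      split_ifs with hjk
      · rw [hjk, if_pos hj] at hi
        rw [← hjk] at hi ⊢
        omega
      · exact hj0
    have hm'I : (m'.support : Set (Fin N)) ⊆ Set.range I := by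
      refine subset_trans (fun j hj => ?_) hmI
      rw [hmm]
      simp only [Finset.mem_coe, Finsupp.mem_support_iff] at hj ⊢
      rw [Finsupp.add_apply]
      omega
    have hm'gen := ihe m' hdeg hηm' hm'I
    have hX : monomial m (1 : K) = substForms K a (dualForm K a I k) * monomial m' 1 +
        ∑ j ∈ Finset.univ.filter (· ∉ Set.range I),
          C (-((∑ r, (simplexMatrix a I)⁻¹ k r * a j r : ℤ) : K)) *
            monomial (m' + Finsupp.single j 1) 1 := by
      have hmon : ∀ j, monomial (m' + Finsupp.single j 1) (1 : K) = X j * monomial m' 1 := by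
        intro j
        rw [add_comm, monomial_single_add, pow_one]
      rw [substForms_dualForm (hdet I hI), hmm, hmon]
      simp only [hmon, C_neg, neg_mul, Finset.sum_neg_distrib, add_mul, Finset.sum_mul, mul_assoc]
      ring
    rw [hX]
    refine (hm'gen.subst_mul _).add (IsGenerated.sum _ fun j hj => IsGenerated.C_mul _ ?_)
    have hjI : j ∉ Set.range I := (Finset.mem_filter.1 hj).2
    by_cases hface : IsSimplex T (m' + Finsupp.single j 1).support
    · obtain ⟨J, hJ, hsubJ, hηJ⟩ := hs.exists_between _ hface
      have hle : m'.support ⊆ (m' + Finsupp.single j 1).support := by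
        intro i hi
        rw [Finsupp.mem_support_iff] at hi ⊢
        rw [Finsupp.add_apply]
        omega
      have hjJ : j ∈ Set.range J := hsubJ (by simp)
      -- The new support still contains `η I`, and `J` contains `j`, which `I` does not.
      have hlt : h J < h I := hs.lt I hI J hJ
        ((Finset.coe_subset.2 (hηm'.trans hle)).trans hsubJ) (fun hJI => hjI (hJI ▸ hjJ))
      refine ihc _ ?_ J hJ rfl _ _ rfl hηJ hsubJ
      rw [← hc]
      refine Finset.card_lt_card (Finset.ssubset_iff_of_subset ?_ |>.2 ⟨J, ?_, ?_⟩)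
      · exact fun L hL => by
          rw [Finset.mem_filter] at hL ⊢
          exact ⟨hL.1, hL.2.trans hlt⟩
      · exact Finset.mem_filter.2 ⟨hJ, hlt⟩
      · simp
    · exact IsGenerated.of_mem (monomial_mem_nonfaceIdeal hface)

theorem isGenerated (hs : IsShelling T h η) (hdet : ∀ I ∈ T, IsUnit (simplexMatrix a I).det)
    (p : MvPolynomial (Fin N) K) : IsGenerated a T η p := by
  rw [p.as_sum]
  refine IsGenerated.sum _ fun m _ => ?_
  rw [← mul_one (coeff m p), ← C_mul_monomial]
  refine IsGenerated.C_mul _ ?_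
  by_cases hface : IsSimplex T m.support
  · obtain ⟨I, hI, hsub, hη⟩ := hs.exists_between _ hface
    exact hs.isGenerated_monomial_of_subset hdet _ I hI rfl _ m rfl hη hsub
  · exact IsGenerated.of_mem (monomial_mem_nonfaceIdeal hface)

/-- Triangularity: restrict to the simplex `J` of greatest `h` among those with nonzero coefficient.
A surviving term of another `I` would need `η I` inside `J`, hence `h J < h I`. -/
theorem eq_zero_of_sum_mem [IsDomain K] (hs : IsShelling T h η)
    (hdet : ∀ I ∈ T, IsUnit (simplexMatrix a I).det)
    {g : (Fin n ↪o Fin N) → MvPolynomial (Fin n) K}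
    (hg : ∑ I ∈ T, substForms K a (g I) * ∏ i ∈ η I, X i ∈ nonfaceIdeal K T) :
    ∀ I ∈ T, g I = 0 := by
  by_contra! hcon
  obtain ⟨I₀, hI₀, hgI₀⟩ := hcon
  classical
  obtain ⟨J, hJ, hmax⟩ := (T.filter fun I => g I ≠ 0).exists_max_image h
    ⟨I₀, Finset.mem_filter.2 ⟨hI₀, hgI₀⟩⟩
  rw [Finset.mem_filter] at hJ
  have hz := restrictSimplex_eq_zero_of_mem (a := a) hJ.1 hg
  simp only [map_sum, map_mul (restrictSimplex K a J), restrictSimplex_substForms (hdet J hJ.1)]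
    at hz
  rw [Finset.sum_eq_single_of_mem J hJ.1] at hz
  · exact (mul_ne_zero hJ.2 (restrictSimplex_prod_ne_zero (hdet J hJ.1)
      (hs.subset_range J hJ.1))) hz
  · intro I hI hne
    by_cases hgI : g I = 0
    · rw [hgI, zero_mul]
    · rw [restrictSimplex_prod_eq_zero, mul_zero]
      intro hsub
      exact (hmax I (Finset.mem_filter.2 ⟨hI, hgI⟩)).not_gt (hs.lt I hI J hJ.1 hsub hne.symm)

/-- Freeness over the polynomial ring in the linear forms descends to the quotient by these forms,
where a coefficient retains only its constant term. -/
theorem nonempty_basis [IsDomain K] (hs : IsShelling T h η)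
    (hdet : ∀ I ∈ T, IsUnit (simplexMatrix a I).det) {𝒥 : Ideal (MvPolynomial (Fin N) K)}
    (h𝒥 : 𝒥 = Ideal.span (Set.range (linearForm K a)) ⊔ nonfaceIdeal K T) :
    Nonempty (Module.Basis T K (MvPolynomial (Fin N) K ⧸ 𝒥)) := by
  let v : T → MvPolynomial (Fin N) K ⧸ 𝒥 := fun I => Ideal.Quotient.mk 𝒥 (∏ i ∈ η I, X i)
  have hmk : ∀ p ∈ nonfaceIdeal K T, Ideal.Quotient.mk 𝒥 p = 0 := fun p hp => by
    rw [Ideal.Quotient.eq_zero_iff_mem, h𝒥]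
    exact Ideal.mem_sup_right hp
  have hsubst : ∀ g : MvPolynomial (Fin n) K, Ideal.Quotient.mk 𝒥 (substForms K a g) =
      algebraMap K _ (constantCoeff g) := by
    intro g
    have : (Ideal.Quotient.mkₐ K 𝒥).comp (substForms K a) =
        (Algebra.ofId K (MvPolynomial (Fin N) K ⧸ 𝒥)).comp (aeval 0) := by
      ext r : 1
      simp only [AlgHom.comp_apply, substForms, aeval_X, Pi.zero_apply, map_zero]
      rw [Ideal.Quotient.mkₐ_eq_mk, Ideal.Quotient.eq_zero_iff_mem, h𝒥]
      exact Ideal.mem_sup_left (Ideal.subset_span ⟨r, rfl⟩)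
    have hg := DFunLike.congr_fun this g
    simpa [aeval_zero, Algebra.ofId_apply] using hg
  have hli : LinearIndependent K v := by
    rw [Fintype.linearIndependent_iff]
    intro x hx
    have hmem : ∑ I : T, C (x I) * ∏ i ∈ η I, X i ∈ 𝒥 := by
      rw [← Ideal.Quotient.eq_zero_iff_mem, ← hx, map_sum]
      refine Finset.sum_congr rfl fun I _ => ?_
      rw [map_mul]
      exact (Algebra.smul_def (x I) (v I)).symm
    rw [h𝒥] at hmem
    obtain ⟨q, hq, s, hsn, hqs⟩ := Submodule.mem_sup.1 hmem
    obtain ⟨p, rfl⟩ := Ideal.mem_span_range_iff_exists_fun.1 hq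
    -- Expanding the multipliers of the linear forms in the same generators yields one relation with
    -- coefficients $x_I-\sum_r X_r g_{r,I}$. These vanish, and their constant terms are the $x_I$.
    choose g hg using fun r => hs.isGenerated (a := a) hdet (p r)
    classical
    let x' : (Fin n ↪o Fin N) → K := fun I => if hI : I ∈ T then x ⟨I, hI⟩ else 0
    have hx' : ∀ I : T, x' I = x I := fun I => dif_pos I.2
    have hzero : ∑ I ∈ T, substForms K a (C (x' I) - ∑ r, X r * g r I) * ∏ i ∈ η I, X i ∈
        nonfaceIdeal K T := by
      have h1 : ∑ r, linearForm K a r * (p r - ∑ I ∈ T, substForms K a (g r I) *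
          ∏ i ∈ η I, X i) ∈ nonfaceIdeal K T :=
        Ideal.sum_mem _ fun r _ => Ideal.mul_mem_left _ _ (hg r)
      convert Ideal.add_mem _ h1 hsn using 1
      have h2 : ∑ I ∈ T, C (x' I) * ∏ i ∈ η I, X i =
          ∑ r, p r * linearForm K a r + s := by
        rw [hqs, ← Finset.sum_coe_sort]
        simp only [hx']
      have hC : ∀ z : K, substForms K a (C z) = C z := fun z => by
        rw [algHom_C, algebraMap_eq]
      have hXr : ∀ r, substForms K a (X r) = linearForm K a r := fun r => aeval_X _ _
      simp only [map_sub, map_sum, map_mul, sub_mul, Finset.sum_sub_distrib, hC, hXr, h2, mul_sub,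
        Finset.mul_sum, Finset.sum_mul]
      rw [Finset.sum_comm]
      simp only [mul_assoc, mul_comm (linearForm K a _) (p _)]
      ring
    intro I
    have hI := hs.eq_zero_of_sum_mem hdet hzero I I.2
    have := congrArg constantCoeff hI
    simpa [hx'] using this
  have hsp : ⊤ ≤ Submodule.span K (Set.range v) := by
    rintro x -
    obtain ⟨p, rfl⟩ := Ideal.Quotient.mk_surjective x
    obtain ⟨g, hg⟩ := hs.isGenerated (a := a) hdet p
    have h0 := hmk _ hg
    rw [map_sub, sub_eq_zero] at h0
    rw [h0, map_sum]
    refine Submodule.sum_mem _ fun I hI => ?_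
    rw [map_mul, hsubst, ← Algebra.smul_def]
    exact Submodule.smul_mem _ _ (Submodule.subset_span ⟨⟨I, hI⟩, rfl⟩)
  exact ⟨Module.Basis.mk hli hsp⟩

end IsShelling

end Coefficients

end

end GKZ

/-! ### Lattice points of the polytope -/

namespace GKZ

noncomputable section

open Matrix

variable {n N : ℕ} {a : Fin N → Fin n → ℤ} {T : Finset (Fin n ↪o Fin N)}

/-- A $\mathbb Z$-basis of the rank $n$ lattice forms an integer matrix with nonzero determinant, so
it remains independent over $\mathbb R$. -/
theorem StandardCondition.eq_zero_of_dotProduct_eq_zero (ha : StandardCondition a)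
    {u : Fin n → ℝ} (hu : ∀ j, u ⬝ᵥ toReal (a j) = 0) : u = 0 := by
  let β := Module.finBasisOfFinrankEq ℤ (Submodule.span ℤ (Set.range a)) ha.rank_span
  let M : Matrix (Fin n) (Fin n) ℤ := Matrix.of fun k => (β k : Fin n → ℤ)
  have hM : M.det ≠ 0 := by
    intro h0
    obtain ⟨v, hv0, hv⟩ := Matrix.exists_vecMul_eq_zero_iff.2 h0
    refine hv0 (funext (Fintype.linearIndependent_iff.1 β.linearIndependent v ?_))
    ext r
    have := congrFun hv r
    simpa [M, Matrix.vecMul, dotProduct] using this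
  have hMR : ((Int.castRingHom ℝ).mapMatrix M).det ≠ 0 := by
    rw [← RingHom.map_det, eq_intCast]
    exact Int.cast_ne_zero.2 hM
  refine Matrix.eq_zero_of_mulVec_eq_zero hMR (funext fun k => ?_)
  have hspan : ∀ z ∈ Submodule.span ℤ (Set.range a), toReal z ⬝ᵥ u = 0 := by
    intro z hz
    refine Submodule.span_induction (p := fun z _ => toReal z ⬝ᵥ u = 0) ?_ ?_ ?_ ?_ hz
    · rintro _ ⟨j, rfl⟩
      rw [dotProduct_comm, hu]
    · simp [toReal, dotProduct]
    · intro x z _ _ hx hz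
      have : toReal (x + z) = toReal x + toReal z := by
        ext
        simp [toReal]
      rw [this, add_dotProduct, hx, hz, add_zero]
    · intro s x _ hx
      have : toReal (s • x) = (s : ℝ) • toReal x := by
        ext
        simp [toReal]
      rw [this, smul_dotProduct, hx, smul_zero]
  exact hspan _ (β k).2

theorem sum_inv_mulVec {I : Fin n ↪o Fin N} (hI : IsUnit (simplexMatrix a I).det)
    (z : Fin n → ℤ) : ∑ k, ((simplexMatrix a I)⁻¹ *ᵥ z) k • a (I k) = z := by
  have h : simplexMatrix a I *ᵥ ((simplexMatrix a I)⁻¹ *ᵥ z) = z := by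
    rw [Matrix.mulVec_mulVec, Matrix.mul_nonsing_inv _ hI, Matrix.one_mulVec]
  conv_rhs => rw [← h]
  ext r
  simp [simplexMatrix, Matrix.mulVec, dotProduct, mul_comm]

theorem coords_toReal {I : Fin n ↪o Fin N} (hI : IsUnit (simplexMatrix a I).det)
    (hind : IndepAt a I) (z : Fin n → ℤ) :
    coords a I (toReal z) = toReal ((simplexMatrix a I)⁻¹ *ᵥ z) := by
  have h : toReal z = colMatrix a I *ᵥ toReal ((simplexMatrix a I)⁻¹ *ᵥ z) := by
    rw [colMatrix_mulVec]
    conv_lhs => rw [← sum_inv_mulVec hI z]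
    ext r
    simp [toReal]
  rw [coords, h, Matrix.mulVec_mulVec, Matrix.nonsing_inv_mul _ (isUnit_det_colMatrix hind),
    Matrix.one_mulVec]

/-- In a unimodular simplex whose cone contains `z`, the coordinates of `z` are nonnegative
integers, with sum $\mathfrak a_0^\vee\cdot z=1$; so exactly one is $1$ and the others are $0$. -/
theorem IsVertexSystem.exists_eq_of_toReal_mem_polytope {d : Fin N → ℝ}
    {y : (Fin n ↪o Fin N) → Fin n → ℝ} (hv : IsVertexSystem a T d y) (hT : T.Nonempty)
    (hcond : ∃ a₀ : Fin n → ℤ, ∀ i, a₀ ⬝ᵥ a i = 1) (huni : IsUnimodular a T) {z : Fin n → ℤ}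
    (hz : toReal z ∈ polytope a) : ∃ I ∈ T, ∃ k, z = a (I k) := by
  obtain ⟨a₀, ha₀⟩ := hcond
  have hone : a₀ ⬝ᵥ z = 1 := by
    have hsub : polytope a ⊆ {x | toReal a₀ ⬝ᵥ x = 1} := by
      refine convexHull_min ?_ ?_
      · rintro _ ⟨j, rfl⟩
        rw [Set.mem_ofPred_eq, toReal_dotProduct, ha₀, Int.cast_one]
      · exact convex_hyperplane (dotProductBilin ℝ ℝ (toReal a₀)).isLinear 1
    have := hsub hz
    rw [Set.mem_ofPred_eq, toReal_dotProduct] at this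
    exact_mod_cast this
  obtain ⟨μ, hμ, -, hx⟩ := mem_convexHull_insert_zero_polytope.1
    (subset_convexHull ℝ _ (Set.mem_insert_of_mem 0 hz))
  obtain ⟨I, hI, hnn⟩ := hv.exists_coords_nonneg hT ⟨μ, hμ, hx⟩
  have hdet := huni.isUnit_det hI
  rw [coords_toReal hdet (hv.indep I hI)] at hnn
  set q := (simplexMatrix a I)⁻¹ *ᵥ z with hq
  have hq0 : ∀ k, 0 ≤ q k := fun k => (Int.cast_nonneg_iff (R := ℝ)).1 (hnn k)
  have hqz : ∑ k, q k • a (I k) = z := sum_inv_mulVec hdet z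
  have hqs : ∑ k, q k = 1 := by
    have := congrArg (a₀ ⬝ᵥ ·) hqz
    simpa only [dotProduct_sum, dotProduct_smul, ha₀, hone, smul_eq_mul, mul_one] using this
  obtain ⟨k, hk⟩ : ∃ k, q k ≠ 0 := by
    by_contra! h
    simp [h] at hqs
  have hk1 : q k = 1 := by
    have h1 := Finset.single_le_sum (fun l _ => hq0 l) (Finset.mem_univ k)
    have h2 := hq0 k
    omega
  have hl : ∀ l ≠ k, q l = 0 := by
    rw [← Finset.add_sum_erase _ _ (Finset.mem_univ k), hk1] at hqs
    have h0 : ∑ l ∈ Finset.univ.erase k, q l = 0 := by omega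
    rw [Finset.sum_eq_zero_iff_of_nonneg fun l _ => hq0 l] at h0
    exact fun l hl => h0 l (Finset.mem_erase.2 ⟨hl, Finset.mem_univ l⟩)
  refine ⟨I, hI, k, ?_⟩
  rw [← hqz, Finset.sum_eq_single k (fun l _ h => by rw [hl l h, zero_smul]) (by simp), hk1,
    one_smul]

theorem vertices_eq_range (ha : Function.Injective a)
    (hmem : ∀ z : Fin n → ℤ, toReal z ∈ polytope a → ∃ I ∈ T, ∃ k, z = a (I k)) :
    (∀ i, IsSimplex T {i}) ∧ polytope a ∩ Set.range toReal = vertices a T ∧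
      vertices a T = Set.range fun i => toReal (a i) := by
  have hpoly : ∀ i, toReal (a i) ∈ polytope a := fun i => subset_convexHull _ _ ⟨i, rfl⟩
  have hsing : ∀ i, IsSimplex T {i} := by
    intro i
    obtain ⟨I, hI, k, hk⟩ := hmem _ (hpoly i)
    exact ⟨I, hI, by simpa using ⟨k, (ha hk).symm⟩⟩
  have hvert : vertices a T = Set.range fun i => toReal (a i) := by
    ext x
    constructor
    · rintro ⟨i, -, rfl⟩
      exact ⟨i, rfl⟩
    · rintro ⟨i, rfl⟩
      exact ⟨i, ⟨hsing i, Finset.card_singleton i⟩, rfl⟩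
  refine ⟨hsing, ?_, hvert⟩
  rw [hvert]
  ext x
  constructor
  · rintro ⟨hx, z, rfl⟩
    obtain ⟨I, -, k, rfl⟩ := hmem z hx
    exact ⟨I k, rfl⟩
  · rintro ⟨i, rfl⟩
    exact ⟨hpoly i, a i, rfl⟩

/-! ### The component of degree one -/

/-- The projection of `ℤ^N` onto `𝕃` along the coordinate sublattice `ℤ^I`. -/
theorem exists_lattice_projection {I : Fin n ↪o Fin N} (hI : IsUnit (simplexMatrix a I).det) :
    ∃ π : (Fin N → ℤ) →ₗ[ℤ] lattice a, (∀ l : lattice a, π l = l) ∧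
      ∀ x j, (π x : Fin N → ℤ) j = x j - ∑ k, ((simplexMatrix a I)⁻¹ *ᵥ ∑ i, x i • a i) k *
        (Pi.single (I k) 1 : Fin N → ℤ) j := by
  -- A section of $\mathsf A:\mathbb Z^N\to\mathbb Z^n$ supported on `I`; the projection is the
  -- identity minus `s` after $\mathsf A$.
  let s : (Fin n → ℤ) →ₗ[ℤ] (Fin N → ℤ) :=
    Fintype.linearCombination ℤ (fun k => (Pi.single (I k) 1 : Fin N → ℤ)) ∘ₗ
      (simplexMatrix a I)⁻¹.mulVecLin
  have hs : ∀ z, Fintype.linearCombination ℤ a (s z) = z := by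
    intro z
    conv_rhs => rw [← sum_inv_mulVec hI z]
    simp only [s, LinearMap.comp_apply, Fintype.linearCombination_apply _ (fun k => Pi.single _ _),
      map_sum, map_smul, Fintype.linearCombination_apply_single, Matrix.mulVecLin_apply, one_smul]
  let p : (Fin N → ℤ) →ₗ[ℤ] (Fin N → ℤ) := LinearMap.id - s ∘ₗ Fintype.linearCombination ℤ a
  have hmem : ∀ x, p x ∈ lattice a := by
    intro x
    rw [lattice, LinearMap.mem_ker]
    simp [p, hs]
  refine ⟨LinearMap.codRestrict _ p hmem, fun l => Subtype.ext ?_, fun x j => ?_⟩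
  · have hl : Fintype.linearCombination ℤ a (l : Fin N → ℤ) = 0 := l.2
    simp [p, hl]
  · change x j - Fintype.linearCombination ℤ (fun k => (Pi.single (I k) 1 : Fin N → ℤ))
      ((simplexMatrix a I)⁻¹ *ᵥ Fintype.linearCombination ℤ a x) j = _
    simp only [Fintype.linearCombination_apply, Finset.sum_apply, Pi.smul_apply, smul_eq_mul]

theorem lattice_sum_eq_zero (l : lattice a) (r : Fin n) :
    ∑ j, (l : Fin N → ℤ) j * a j r = 0 := by
  have hl : Fintype.linearCombination ℤ a (l : Fin N → ℤ) = 0 := l.2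
  have := congrFun hl r
  simpa [Fintype.linearCombination_apply] using this

theorem linearCombination_b_apply (m : Fin N → ℤ) (l : lattice a) :
    Fintype.linearCombination ℤ (b a) m l = ∑ j, m j * (l : Fin N → ℤ) j := by
  simp [Fintype.linearCombination_apply, LinearMap.sum_apply, b]

/-- $\mathbb L$ is a direct summand of $\mathbb Z^N$, so every functional on it extends by
composition with the projection. -/
theorem linearCombination_b_surjective {I : Fin n ↪o Fin N}
    (hI : IsUnit (simplexMatrix a I).det) :
    Function.Surjective (Fintype.linearCombination ℤ (b a)) := by
  obtain ⟨π, hπ, -⟩ := exists_lattice_projection hI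
  intro f
  refine ⟨fun j => f (π (Pi.single j 1)), LinearMap.ext fun l => ?_⟩
  rw [linearCombination_b_apply]
  conv_rhs => rw [← hπ l, pi_eq_sum_univ' (l : Fin N → ℤ)]
  simp only [map_sum, map_smul, smul_eq_mul]
  refine Finset.sum_congr rfl fun j _ => ?_
  rw [mul_comm]

/-- A linear form vanishing on `𝕃` is an integral combination of the rows of `𝖠`. -/
theorem exists_row_combination {I : Fin n ↪o Fin N} (hI : IsUnit (simplexMatrix a I).det)
    {m : Fin N → ℤ} (hm : Fintype.linearCombination ℤ (b a) m = 0) :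
    ∃ t : Fin n → ℤ, ∀ j, m j = ∑ r, t r * a j r := by
  obtain ⟨π, -, hπ⟩ := exists_lattice_projection hI
  refine ⟨fun r => ∑ k, m (I k) * (simplexMatrix a I)⁻¹ k r, fun j => ?_⟩
  -- Since `m` vanishes on the projection of the unit vector $e_j$, the entry $m_j$ is determined by
  -- the entries at `I`.
  have h := linearCombination_b_apply m (π (Pi.single j 1))
  rw [hm, LinearMap.zero_apply] at h
  simp only [hπ, mul_sub, Finset.sum_sub_distrib, Finset.mul_sum] at h
  rw [Finset.sum_comm] at h
  have hsingle : ∀ k, ∑ i, m i * (((simplexMatrix a I)⁻¹ *ᵥ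
      ∑ i, (Pi.single j 1 : Fin N → ℤ) i • a i) k * (Pi.single (I k) 1 : Fin N → ℤ) i) =
      ∑ r, m (I k) * (simplexMatrix a I)⁻¹ k r * a j r := by
    intro k
    rw [Finset.sum_eq_single (I k) (fun i _ hi => by rw [Pi.single_eq_of_ne hi]; simp) (by simp),
      Finset.sum_eq_single j (fun i _ hi => by rw [Pi.single_eq_of_ne hi, zero_smul]) (by simp)]
    simp [Matrix.mulVec, dotProduct, Finset.mul_sum, mul_assoc]
  rw [Finset.sum_congr rfl fun k _ => hsingle k, Finset.sum_comm,
    Finset.sum_eq_single j (fun i _ hi => by rw [Pi.single_eq_of_ne hi, mul_zero]) (by simp),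
    Pi.single_eq_same, mul_one] at h
  simp only [Finset.sum_mul]
  linarith

theorem exists_linearEquiv_of_ker_eq {R A B C : Type*} [Ring R] [AddCommGroup A] [AddCommGroup B]
    [AddCommGroup C] [Module R A] [Module R B] [Module R C] {f : A →ₗ[R] B} {g : A →ₗ[R] C}
    (hf : Function.Surjective f) (hg : Function.Surjective g)
    (hker : LinearMap.ker f = LinearMap.ker g) : ∃ e : B ≃ₗ[R] C, ∀ x, e (f x) = g x := by
  refine ⟨(f.quotKerEquivOfSurjective hf).symm ≪≫ₗ Submodule.quotEquivOfEq _ _ hker ≪≫ₗ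
    g.quotKerEquivOfSurjective hg, fun x => ?_⟩
  have : (f.quotKerEquivOfSurjective hf).symm (f x) = Submodule.Quotient.mk x := by
    rw [LinearEquiv.symm_apply_eq]
    rfl
  simp only [LinearEquiv.trans_apply, this, Submodule.quotEquivOfEq_mk]
  rfl

theorem IsUnimodular.volumeProduct_eq_one (huni : IsUnimodular a T) : volumeProduct a T = 1 :=
  Finset.prod_eq_one huni

theorem intCast_bijective_intAdjoinInv {D : ℤ} (hD : D = 1) :
    Function.Bijective (Int.castRingHom (intAdjoinInv D)) := by
  subst hD
  refine ⟨Int.cast_injective, ?_⟩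
  rintro ⟨x, hx⟩
  have hle : intAdjoinInv 1 ≤ (Int.castRingHom ℚ).range := by
    refine Subring.closure_le.2 ?_
    rintro _ rfl
    exact ⟨1, by simp⟩
  obtain ⟨z, rfl⟩ := hle hx
  exact ⟨z, Subtype.ext (by simp)⟩

/-- For a unimodular triangulation the coefficient ring is `ℤ`. -/
theorem IsUnimodular.exists_coeffRing_equiv (huni : IsUnimodular a T) :
    Nonempty (CoeffRing a T ≃+* ℤ) := by
  have h : Function.Bijective (Int.castRingHom (CoeffRing a T)) :=
    intCast_bijective_intAdjoinInv huni.volumeProduct_eq_one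
  exact ⟨(RingEquiv.ofBijective _ h).symm⟩

theorem relationIdeal_eq : relationIdeal a T =
    Ideal.span (Set.range (linearForm (CoeffRing a T) a)) ⊔ nonfaceIdeal (CoeffRing a T) T :=
  Ideal.span_union _ _

theorem intCast_smul_eq_of_equiv {K M : Type*} [CommRing K] [AddCommGroup M] [Module K M]
    (κ : K ≃+* ℤ) (x : K) (m : M) : κ x • m = x • m := by
  have hx : x = ((κ x : ℤ) : K) := by
    apply κ.injective
    rw [map_intCast, Int.cast_id]
  conv_rhs => rw [hx, Int.cast_smul_eq_zsmul]

theorem gradedPart_one_eq (κ : CoeffRing a T ≃+* ℤ) (x : RingR a T) :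
    x ∈ gradedPart a T 1 ↔ ∃ m : Fin N → ℤ, ∑ j, m j • c a T j = x := by
  rw [gradedPart, MvPolynomial.homogeneousSubmodule_one_eq_span_X, Submodule.map_span,
    ← Set.range_comp]
  refine (Submodule.mem_span_range_iff_exists_fun _).trans ⟨?_, ?_⟩
  · rintro ⟨t, ht⟩
    refine ⟨fun j => κ (t j), ?_⟩
    simp only [intCast_smul_eq_of_equiv]
    exact ht
  · rintro ⟨m, hm⟩
    refine ⟨fun j => (m j : CoeffRing a T), ?_⟩
    simp only [Int.cast_smul_eq_zsmul]
    exact hm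

theorem sum_smul_c_eq_zero (r : Fin n) : ∑ j, a j r • c a T j = 0 := by
  have hmem : linearForm (CoeffRing a T) a r ∈ relationIdeal a T := by
    rw [relationIdeal_eq]
    exact Ideal.mem_sup_left (Ideal.subset_span ⟨r, rfl⟩)
  rw [← Ideal.Quotient.eq_zero_iff_mem, linearForm, map_sum] at hmem
  rw [← hmem]
  refine Finset.sum_congr rfl fun j _ => ?_
  rw [map_mul, map_intCast, map_intCast, zsmul_eq_mul]
  rfl

/-- The map `c_j ↦ 𝔟_j` on the part of degree `1` is well defined: it comes from a ring homomorphism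
to the square-zero extension of `ℤ` by `𝕃_ℤ^∨`. -/
theorem linearCombination_b_eq_zero (κ : CoeffRing a T ≃+* ℤ) (hT : T.Nonempty)
    (hsing : ∀ i, IsSimplex T {i}) {m : Fin N → ℤ} (hm : ∑ j, m j • c a T j = 0) :
    Fintype.linearCombination ℤ (b a) m = 0 := by
  let ψ : MvPolynomial (Fin N) (CoeffRing a T) →+*
      TrivSqZeroExt ℤ (Module.Dual ℤ (lattice a)) :=
    MvPolynomial.eval₂Hom ((TrivSqZeroExt.inlHom ℤ _).comp κ.toRingHom)
      fun j => TrivSqZeroExt.inr (b a j)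
  have hsum : ∀ m : Fin N → ℤ, ∑ j, ((m j : ℤ) : TrivSqZeroExt ℤ (Module.Dual ℤ (lattice a))) *
      TrivSqZeroExt.inr (b a j) =
        TrivSqZeroExt.inr (Fintype.linearCombination ℤ (b a) m) := by
    intro m
    rw [Fintype.linearCombination_apply, TrivSqZeroExt.inr_sum]
    refine Finset.sum_congr rfl fun j _ => ?_
    rw [← zsmul_eq_mul, TrivSqZeroExt.inr_smul]
  have hker : relationIdeal a T ≤ RingHom.ker ψ := by
    refine Ideal.span_le.2 (Set.union_subset ?_ ?_)
    · rintro _ ⟨r, rfl⟩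
      rw [SetLike.mem_coe, RingHom.mem_ker, map_sum]
      have : Fintype.linearCombination ℤ (b a) (fun j => a j r) = 0 := LinearMap.ext fun l => by
        rw [linearCombination_b_apply, LinearMap.zero_apply, ← lattice_sum_eq_zero l r]
        exact Finset.sum_congr rfl fun j _ => mul_comm _ _
      rw [← TrivSqZeroExt.inr_zero (R := ℤ), ← this, ← hsum]
      refine Finset.sum_congr rfl fun j _ => ?_
      rw [map_mul, map_intCast, map_intCast, MvPolynomial.eval₂Hom_X']
    · rintro _ ⟨F, hF, rfl⟩
      -- The empty set and all singletons are simplices, so a nonface monomial has two factors, each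
      -- sent to the square-zero ideal.
      have hF1 : 1 < F.card := by
        by_contra! hcard
        obtain hne | ⟨i, hi⟩ := F.eq_empty_or_nonempty
        · obtain ⟨I, hI⟩ := hT
          exact hF ⟨I, hI, by simp [hne]⟩
        · refine hF ?_
          rw [Finset.eq_singleton_iff_unique_mem.2
            ⟨hi, fun j hj => Finset.card_le_one.1 hcard j hj i hi⟩]
          exact hsing i
      obtain ⟨i, hi, j, hj, hij⟩ := Finset.one_lt_card.1 hF1
      rw [SetLike.mem_coe, RingHom.mem_ker, map_prod, ← Finset.mul_prod_erase _ _ hi,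
        ← Finset.mul_prod_erase _ _ (Finset.mem_erase.2 ⟨hij.symm, hj⟩), ← mul_assoc,
        MvPolynomial.eval₂Hom_X', MvPolynomial.eval₂Hom_X', TrivSqZeroExt.inr_mul_inr, zero_mul]
  have hmem : ∑ j, m j • (MvPolynomial.X j : MvPolynomial (Fin N) (CoeffRing a T)) ∈
      relationIdeal a T := by
    rw [← Ideal.Quotient.eq_zero_iff_mem, map_sum, ← hm]
    exact Finset.sum_congr rfl fun j _ => map_zsmul _ _ _
  have hzero := RingHom.mem_ker.1 (hker hmem)
  rw [map_sum] at hzero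
  apply TrivSqZeroExt.inr_injective (R := ℤ)
  rw [← hsum, TrivSqZeroExt.inr_zero, ← hzero]
  refine Finset.sum_congr rfl fun j _ => ?_
  rw [map_zsmul, zsmul_eq_mul, MvPolynomial.eval₂Hom_X']

/-- The $c_j$ and the $\mathfrak b_j$ define surjections from $\mathbb Z^N$ with the same kernel,
the row lattice of $\mathsf A$. -/
theorem exists_gradedPart_one_equiv (κ : CoeffRing a T ≃+* ℤ) {I : Fin n ↪o Fin N} (hIT : I ∈ T)
    (hI : IsUnit (simplexMatrix a I).det) (hsing : ∀ i, IsSimplex T {i}) :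
    ∃ e : gradedPart a T 1 ≃ₗ[ℤ] Module.Dual ℤ (lattice a),
      ∀ j : Fin N, e.symm (b a j) = c a T j := by
  have hc : ∀ j, c a T j ∈ gradedPart a T 1 := fun j =>
    (gradedPart_one_eq κ _).2 ⟨Pi.single j 1, by simp [Pi.single_apply, ite_smul]⟩
  let f : (Fin N → ℤ) →ₗ[ℤ] gradedPart a T 1 :=
    Fintype.linearCombination ℤ fun j => (⟨c a T j, hc j⟩ : gradedPart a T 1)
  have hfv : ∀ m, (f m : RingR a T) = ∑ j, m j • c a T j := fun m => by
    rw [Fintype.linearCombination_apply, AddSubmonoidClass.coe_finsetSum]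
    rfl
  have hf : Function.Surjective f := by
    rintro ⟨x, hx⟩
    obtain ⟨m, hm⟩ := (gradedPart_one_eq κ x).1 hx
    exact ⟨m, Subtype.ext ((hfv m).trans hm)⟩
  have hker : LinearMap.ker f = LinearMap.ker (Fintype.linearCombination ℤ (b a)) := by
    ext m
    rw [LinearMap.mem_ker, LinearMap.mem_ker]
    constructor
    · intro h
      refine linearCombination_b_eq_zero κ ⟨I, hIT⟩ hsing ?_
      rw [← hfv, h, ZeroMemClass.coe_zero]
    · intro h
      obtain ⟨t, ht⟩ := exists_row_combination hI h
      refine Subtype.ext ?_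
      rw [hfv, ZeroMemClass.coe_zero]
      simp only [ht, Finset.sum_smul, mul_smul]
      rw [Finset.sum_comm]
      simp only [← Finset.smul_sum, sum_smul_c_eq_zero, smul_zero, Finset.sum_const_zero]
  obtain ⟨e, he⟩ := exists_linearEquiv_of_ker_eq hf (linearCombination_b_surjective hI) hker
  refine ⟨e, fun j => ?_⟩
  have hb : b a j = e (f (Pi.single j 1)) := by
    rw [he, Fintype.linearCombination_apply_single, one_smul]
  rw [hb, LinearEquiv.symm_apply_apply]
  simp [f, Fintype.linearCombination_apply_single]

end

end GKZ

theorem mainTheorem10 {n N : ℕ} (hn : 0 < n) (a : Fin N → Fin n → ℤ)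
    (ha : Function.Injective a) (hcond : GKZ.StandardCondition a)
    (T : Finset (Fin n ↪o Fin N)) (hreg : GKZ.IsRegularTriangulation a T)
    (huni : GKZ.IsUnimodular a T) :
    (Module.Free ℤ (GKZ.RingR a T) ∧ Module.Finite ℤ (GKZ.RingR a T) ∧
      (Module.finrank ℤ (GKZ.RingR a T) : ℝ) = GKZ.normalizedVolume (GKZ.polytope a)) ∧
    (GKZ.polytope a ∩ Set.range GKZ.toReal = GKZ.vertices a T ∧
      GKZ.vertices a T = Set.range fun i => GKZ.toReal (a i)) ∧
    (∃ e : GKZ.gradedPart a T 1 ≃ₗ[ℤ] Module.Dual ℤ (GKZ.lattice a),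
      ∀ j : Fin N, e.symm (GKZ.b a j) = GKZ.c a T j) := by
  obtain ⟨d, y, hv⟩ := hreg.exists_isVertexSystem
  have hT : T.Nonempty := hv.nonempty fun u hu => hcond.eq_zero_of_dotProduct_eq_zero hu
  obtain ⟨h, η, hs⟩ := hv.exists_isShelling
  obtain ⟨κ⟩ := huni.exists_coeffRing_equiv
  have hdet : ∀ I ∈ T, IsUnit (GKZ.simplexMatrix a I).det := fun I hI => huni.isUnit_det hI
  obtain ⟨β⟩ := hs.nonempty_basis hdet (GKZ.relationIdeal_eq (a := a) (T := T))
  -- Since $D=1$, the coefficient ring is $\mathbb Z$, and the basis over it is a $\mathbb Z$-basis.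
  have βZ : Module.Basis T ℤ (GKZ.RingR a T) :=
    β.mapCoeffs κ fun x m => GKZ.intCast_smul_eq_of_equiv κ x m
  obtain ⟨hsing, hvert⟩ := GKZ.vertices_eq_range ha fun z hz =>
    hv.exists_eq_of_toReal_mem_polytope hT hcond.hyperplane huni hz
  obtain ⟨I, hI⟩ := hT
  refine ⟨⟨Module.Free.of_basis βZ, Module.Finite.of_basis βZ, ?_⟩, hvert,
    GKZ.exists_gradedPart_one_equiv κ hI (hdet I hI) hsing⟩
  rw [hv.normalizedVolume_polytope ⟨I, hI⟩ hn hcond.hyperplane huni,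
    Module.finrank_eq_card_basis βZ, Fintype.card_coe]
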